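/- Let $W=\bigoplus_{k\ge 0}W^{-k}$ be a non-positively graded finite-dimensional real vector space, let $U\subset W^0$ be open, and let $$\mathcal A_{W|_U}=C^\infty(U)\otimes S\bigl((W^{<0})^*\bigr)$$ be the graded-commutative algebra in which $C^\infty(U)$ has degree $0$, elements of $(W^{-k})^*$ ($k\geq 1$) have degree $k$, and $S$ denotes the free graded-commutative algebra; linear forms on $W^0$ are regarded as elements of $C^\infty(U)$, so that $W^*\subset\mathcal A_{W|_U}$. Let $Q$ be a differential on $\mathcal A_{W|_U}$, i.e. an $\mathbb R$-linear graded derivation of degree $1$ with $Q^2=0$. Let $N\subset\mathbb R^n$ be an $n$-dimensional submanifold with corners that is star-shaped with respect to the origin. Put $\Omega(N,W)^m=\bigoplus_{k\ge0}\Omega^{m+k}(N)\otimes W^{-k}$ (smooth forms), and let $\Omega(N,W|_U)^0\subset\Omega(N,W)^0$ be the set of those $A$ whose $0$-form part (a map $N\to W^0$) takes values in $U$. Such an $A$ determines a morphism of graded algebras $\mathcal A_{W|_U}\to\Omega(N)$, $F\mapsto F(A)$, given by $f\mapsto f\circ A^{(0)}$ for $f\in C^\infty(U)$, where $A^{(0)}$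 is the $0$-form part of $A$, and by $\xi\mapsto\langle A,\xi\rangle$ for $\xi\in W^*$. Define $F_Q(A)\in\Omega(N,W)^1$ by $\langle F_Q(A),\xi\rangle=(Q\xi)(A)$ for all $\xi\in W^*$. Let $h:\Omega^{\bullet}(N)\to\Omega^{\bullet-1}(N)$ be the de Rham homotopy operator of the radial contraction $R(x,t)=tx$, i.e. for $\alpha\in\Omega^{k+1}(N)$ $$(h\alpha)_x(v_1,\dots,v_k)=\int_0^1 t^{k}\,\alpha_{tx}(x,v_1,\dots,v_k)\,dt ,$$ extended to $W$-valued forms componentwise. Then for every $A\in\Omega(N,W|_U)^0$ the form $$B=A-h(F_Q(A))$$ belongs to $\Omega(N,W)^0$, and $A$ satisfies the generalized Maurer–Cartan equation $dA=F_Q(A)$ if and only if $dB=0$. -/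

import Mathlib

noncomputable section

namespace GradedMC

open scoped Manifold ContDiff TensorProduct DirectSum
open TopologicalSpace

/-! ### The exterior algebra of the dual space and alternating forms -/

/-- The space `ℝⁿ`. -/
abbrev E (n : ℕ) : Type := EuclideanSpace ℝ (Fin n)

/-- The algebra `⋀ (ℝⁿ)*` with the wedge product. -/
abbrev Lam (n : ℕ) : Type := ExteriorAlgebra ℝ (Module.Dual ℝ (E n))

/-- The standard basis `e₁, …, eₙ` of `ℝⁿ`. -/
abbrev stdBasis (n : ℕ) : Module.Basis (Fin n) ℝ (E n) :=
  (EuclideanSpace.basisFun (Fin n) ℝ).toBasis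

theorem multilinear_expand {M F ι : Type*} [AddCommGroup M] [Module ℝ M] [AddCommGroup F]
    [Module ℝ F] [Fintype ι] [DecidableEq ι] (b : Module.Basis ι ℝ M) {k : ℕ}
    (f : MultilinearMap ℝ (fun _ : Fin k => M) F) (v : Fin k → M) :
    f v = ∑ g : Fin k → ι, (∏ i, b.coord (g i) (v i)) • f (fun i => b (g i)) := by
  have h : v = fun i => ∑ j, b.coord j (v i) • b j := by
    funext i
    simp
  conv_lhs => rw [h, MultilinearMap.map_sum]
  exact Finset.sum_congr rfl fun g _ => f.map_smul_univ _ _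

theorem alternating_expand {M F ι : Type*} [AddCommGroup M] [Module ℝ M] [AddCommGroup F]
    [Module ℝ F] [Fintype ι] [DecidableEq ι] (b : Module.Basis ι ℝ M) {k : ℕ}
    (f : M [⋀^Fin k]→ₗ[ℝ] F) (v : Fin k → M) :
    ∑ g : Fin k → ι, (Matrix.of fun i j => b.coord (g j) (v i)).det • f (fun i => b (g i)) =
      (k.factorial : ℝ) • f v := by
  simp only [Matrix.det_apply, Matrix.of_apply, Finset.sum_smul]
  rw [Finset.sum_comm]
  have key : ∀ σ : Equiv.Perm (Fin k), ∑ g : Fin k → ι,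
      (Equiv.Perm.sign σ • ∏ i, b.coord (g i) (v (σ i))) • f (fun i => b (g i)) = f v := by
    intro σ
    have h1 := multilinear_expand b f.toMultilinearMap (v ∘ σ)
    have h2 : f (v ∘ σ) = Equiv.Perm.sign σ • f v := f.map_perm v σ
    simp only [smul_assoc, ← Finset.smul_sum]
    have h3 : ∑ g : Fin k → ι, (∏ i, b.coord (g i) (v (σ i))) • f (fun i => b (g i)) =
        f (v ∘ σ) := h1.symm
    rw [h3, h2, smul_smul, Int.units_mul_self, one_smul]
  rw [Finset.sum_congr rfl fun σ _ => key σ]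
  simp [Finset.card_univ, Fintype.card_perm, Nat.cast_smul_eq_nsmul]

/-- On `ℝⁿ` every alternating form is continuous. -/
def toContAlt {n k : ℕ} (f : E n [⋀^Fin k]→ₗ[ℝ] ℝ) : E n [⋀^Fin k]→L[ℝ] ℝ :=
  { f with
    cont := by
      have h : (f : (Fin k → E n) → ℝ) = fun v => ∑ g : Fin k → Fin n,
          (∏ i, (stdBasis n).coord (g i) (v i)) • f (fun i => stdBasis n (g i)) :=
        funext fun v => multilinear_expand (stdBasis n) f.toMultilinearMap v
      change Continuous (f : (Fin k → E n) → ℝ)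
      rw [h]
      refine continuous_finsetSum _ fun g _ => ?_
      have hp : Continuous fun v : Fin k → E n => ∏ i, (stdBasis n).coord (g i) (v i) := by
        refine continuous_finsetProd _ fun i _ => ?_
        have hc : Continuous ((stdBasis n).coord (g i)) :=
          LinearMap.continuous_of_finiteDimensional _
        exact hc.comp (continuous_apply i)
      exact hp.smul continuous_const }

/-- The map `⋀ᵏ (ℝⁿ)* → Altᵏ(ℝⁿ)`, with
`(φ₁ ∧ ⋯ ∧ φₖ)(v₁, …, vₖ) = det (φⱼ (vᵢ))`. -/
def toAlt (n k : ℕ) : (⋀[ℝ]^k (Module.Dual ℝ (E n))) →ₗ[ℝ] E n [⋀^Fin k]→L[ℝ] ℝ where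
  toFun a := toContAlt
    (exteriorPower.alternatingMapLinearEquiv.symm (exteriorPower.pairingDual ℝ (E n) k a))
  map_add' a b := by ext v; simp [toContAlt]; rfl
  map_smul' c a := by ext v; simp [toContAlt]; rfl

theorem toAlt_ιMulti {n k : ℕ} (φ : Fin k → Module.Dual ℝ (E n)) (v : Fin k → E n) :
    toAlt n k (exteriorPower.ιMulti ℝ k φ) v = (Matrix.of fun i j => φ j (v i)).det := by
  change exteriorPower.alternatingMapLinearEquiv.symm _ v = _
  rw [exteriorPower.alternatingMapLinearEquiv_symm_apply]
  exact exteriorPower.pairingDual_ιMulti_ιMulti φ v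

/-- The map `Altᵏ(ℝⁿ) → ⋀ᵏ (ℝⁿ)*`,
`α ↦ (1/k!) ∑ α(e_{g₁}, …, e_{gₖ}) dx^{g₁} ∧ ⋯ ∧ dx^{gₖ}`. -/
def ofAlt (n k : ℕ) : (E n [⋀^Fin k]→L[ℝ] ℝ) →ₗ[ℝ] ⋀[ℝ]^k (Module.Dual ℝ (E n)) where
  toFun α := (k.factorial : ℝ)⁻¹ • ∑ g : Fin k → Fin n,
    α (fun i => stdBasis n (g i)) •
      exteriorPower.ιMulti ℝ k (fun i => (stdBasis n).coord (g i))
  map_add' a b := by simp [add_smul, Finset.sum_add_distrib]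
  map_smul' c a := by
    simp only [ContinuousAlternatingMap.smul_apply, smul_assoc, ← Finset.smul_sum,
      RingHom.id_apply]
    rw [smul_comm]

/-- The identification `⋀ᵏ (ℝⁿ)* ≃ Altᵏ(ℝⁿ)`. -/
def formEquiv (n k : ℕ) :
    (⋀[ℝ]^k (Module.Dual ℝ (E n))) ≃ₗ[ℝ] E n [⋀^Fin k]→L[ℝ] ℝ :=
  LinearEquiv.ofLinearMap (toAlt n k) (ofAlt n k)
    (by
      ext α v
      have h := alternating_expand (stdBasis n) α.toAlternatingMap v
      simp only [LinearMap.comp_apply, LinearMap.id_apply, ofAlt, LinearMap.coe_mk,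
        AddHom.coe_mk, map_smul, map_sum, ContinuousAlternatingMap.smul_apply,
        ContinuousAlternatingMap.sum_apply, toAlt_ιMulti]
      rw [inv_smul_eq_iff₀ (by positivity)]
      refine Eq.trans ?_ h
      exact Finset.sum_congr rfl fun g _ => mul_comm _ _)
    (by
      apply exteriorPower.linearMap_ext
      ext φ
      have h := alternating_expand (stdBasis n).dualBasis
        (exteriorPower.ιMulti ℝ k (M := Module.Dual ℝ (E n))) φ
      simp only [LinearMap.compAlternatingMap_apply, LinearMap.comp_apply, LinearMap.id_apply,
        ofAlt, LinearMap.coe_mk, AddHom.coe_mk, toAlt_ιMulti]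
      congr 1
      rw [inv_smul_eq_iff₀ (by positivity), ← h]
      refine Finset.sum_congr rfl fun g _ => ?_
      rw [← Matrix.det_transpose]
      congr 2
      · ext i j
        simp
      · funext i
        simp)

/-- The `k`-form component of an element of `⋀ (ℝⁿ)*`. -/
def toForm (n k : ℕ) : Lam n →ₗ[ℝ] E n [⋀^Fin k]→L[ℝ] ℝ :=
  (formEquiv n k).toLinearMap ∘ₗ
    DirectSum.component ℝ ℕ (fun i : ℕ => ⋀[ℝ]^i (Module.Dual ℝ (E n))) k ∘ₗ
      (DirectSum.decomposeLinearEquiv fun i : ℕ => ⋀[ℝ]^i (Module.Dual ℝ (E n))).toLinearMap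

theorem ι_mul_ιMulti {M : Type*} [AddCommGroup M] [Module ℝ M] (x : M) :
    ∀ (j : ℕ) (v : Fin j → M),
      ExteriorAlgebra.ι ℝ x * ExteriorAlgebra.ιMulti ℝ j v =
        (-1 : ℝ) ^ j • (ExteriorAlgebra.ιMulti ℝ j v * ExteriorAlgebra.ι ℝ x)
  | 0, v => by simp
  | j + 1, v => by
    have h : ExteriorAlgebra.ι ℝ x * ExteriorAlgebra.ι ℝ (v 0) =
        -(ExteriorAlgebra.ι ℝ (v 0) * ExteriorAlgebra.ι ℝ x) :=
      eq_neg_of_add_eq_zero_left (ExteriorAlgebra.ι_add_mul_swap x (v 0))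
    rw [ExteriorAlgebra.ιMulti_succ_apply, ← mul_assoc, h, neg_mul, mul_assoc,
      ι_mul_ιMulti x j, mul_smul_comm, ← mul_assoc, pow_succ, mul_neg_one, neg_smul]

theorem graded_comm {M : Type*} [AddCommGroup M] [Module ℝ M] {i j : ℕ}
    {a b : ExteriorAlgebra ℝ M} (ha : a ∈ ⋀[ℝ]^i M) (hb : b ∈ ⋀[ℝ]^j M) :
    a * b = (-1 : ℝ) ^ (i * j) • (b * a) := by
  have h1 : ∀ (i : ℕ) (u : Fin i → M) (v : Fin j → M),
      ExteriorAlgebra.ιMulti ℝ i u * ExteriorAlgebra.ιMulti ℝ j v =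
        (-1 : ℝ) ^ (i * j) •
          (ExteriorAlgebra.ιMulti ℝ j v * ExteriorAlgebra.ιMulti ℝ i u) := by
    intro i
    induction i with
    | zero => intro u v; simp
    | succ i ih =>
      intro u v
      rw [ExteriorAlgebra.ιMulti_succ_apply, mul_assoc, ih, mul_smul_comm, ← mul_assoc,
        ι_mul_ιMulti, smul_mul_assoc, smul_smul, mul_assoc, ← pow_add, Nat.succ_mul]
  rw [← ExteriorAlgebra.ιMulti_span_fixedDegree] at ha hb
  induction ha using Submodule.span_induction with
  | mem a ha =>
    obtain ⟨u, rfl⟩ := ha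
    induction hb using Submodule.span_induction with
    | mem b hb => obtain ⟨v, rfl⟩ := hb; exact h1 i u v
    | zero => simp
    | add b b' _ _ h h' => rw [mul_add, add_mul, smul_add, h, h']
    | smul c b _ h => rw [mul_smul_comm, smul_mul_assoc, h, smul_comm]
  | zero => simp
  | add a a' _ _ h h' => rw [mul_add, add_mul, smul_add, h, h']
  | smul c a _ h => rw [mul_smul_comm, smul_mul_assoc, h, smul_comm]

/-! ### The algebra of functions on the graded manifold `W|_U`

A non-positively graded vector space `W = ⨁ W⁻ᵏ` is given by the family `k ↦ W k`, where `W k`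
is the component of degree `-k`; linear coordinates on `W k` have degree `k`. -/

section Algebra

variable (W : ℕ → Type*) [∀ k, NormedAddCommGroup (W k)] [∀ k, NormedSpace ℝ (W k)]

/-- The dual `(W^{<0})*`; the summand with index `k` is the dual of the component of degree
`-(k+1)`. -/
abbrev NegDual : Type _ := ⨁ k : ℕ, StrongDual ℝ (W (k + 1))

/-- The generator of the tensor algebra given by a linear form on the component of degree
`-(k+1)`. -/
def tgen (k : ℕ) (ξ : StrongDual ℝ (W (k + 1))) : TensorAlgebra ℝ (NegDual W) :=
  TensorAlgebra.ι ℝ (DirectSum.lof ℝ ℕ (fun k => StrongDual ℝ (W (k + 1))) k ξ)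

/-- Graded commutativity: `ξ η = (-1)^{deg ξ deg η} η ξ`. -/
inductive SymRel : TensorAlgebra ℝ (NegDual W) → TensorAlgebra ℝ (NegDual W) → Prop
  | comm (i j : ℕ) (ξ : StrongDual ℝ (W (i + 1))) (η : StrongDual ℝ (W (j + 1))) :
      SymRel (tgen W i ξ * tgen W j η)
        ((-1 : ℝ) ^ ((i + 1) * (j + 1)) • (tgen W j η * tgen W i ξ))

/-- The free graded-commutative algebra `S((W^{<0})*)`. -/
abbrev GradedSym : Type _ := RingQuot (SymRel W)

/-- The generator of degree `k+1` of `S((W^{<0})*)` given by a linear form on the component of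
degree `-(k+1)`. -/
def sgen (k : ℕ) : StrongDual ℝ (W (k + 1)) →ₗ[ℝ] GradedSym W :=
  (RingQuot.mkAlgHom ℝ (SymRel W)).toLinearMap ∘ₗ TensorAlgebra.ι ℝ ∘ₗ
    DirectSum.lof ℝ ℕ (fun k => StrongDual ℝ (W (k + 1))) k

/-- The homogeneous component of degree `m` of `S((W^{<0})*)`. -/
def symDeg (m : ℕ) : Submodule ℝ (GradedSym W) :=
  Submodule.span ℝ {s | ∃ L : List (Σ k : ℕ, StrongDual ℝ (W (k + 1))),
    (L.map fun p => p.1 + 1).sum = m ∧ s = (L.map fun p => sgen W p.1 p.2).prod}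

variable {W}

/-- The algebra `C^∞(U)`. -/
abbrev Smooth (U : Opens (W 0)) : Type _ := C^∞⟮𝓘(ℝ, W 0), U; 𝓘(ℝ, ℝ), ℝ⟯

/-- The algebra `𝒜_{W|_U} = C^∞(U) ⊗ S((W^{<0})*)`. -/
abbrev Alg (U : Opens (W 0)) : Type _ := Smooth U ⊗[ℝ] GradedSym W

/-- The homogeneous component of degree `m` of `𝒜_{W|_U}` (elements of `C^∞(U)` have
degree `0`). -/
def algDeg (U : Opens (W 0)) (m : ℕ) : Submodule ℝ (Alg U) :=
  Submodule.span ℝ {a | ∃ (f : Smooth U) (s : GradedSym W), s ∈ symDeg W m ∧ a = f ⊗ₜ[ℝ] s}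

/-- The restriction to `U` of a linear form on `W⁰`. -/
def linSmooth (U : Opens (W 0)) : StrongDual ℝ (W 0) →ₗ[ℝ] Smooth U where
  toFun ξ := ⟨fun u => ξ u, ξ.contMDiff.comp contMDiff_subtype_val⟩
  map_add' _ _ := rfl
  map_smul' _ _ := rfl

/-- The inclusion `W* → 𝒜_{W|_U}`. -/
def coordFn (U : Opens (W 0)) : ∀ k : ℕ, StrongDual ℝ (W k) →ₗ[ℝ] Alg U
  | 0 => (Algebra.TensorProduct.includeLeft (R := ℝ) (S := ℝ) (A := Smooth U)
      (B := GradedSym W)).toLinearMap ∘ₗ linSmooth U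
  | k + 1 => (Algebra.TensorProduct.includeRight (R := ℝ) (A := Smooth U)
      (B := GradedSym W)).toLinearMap ∘ₗ sgen W k

/-- A differential on the graded algebra `𝒜_{W|_U}`: a derivation of degree `1` with
square zero. -/
structure Differential (U : Opens (W 0)) where
  /-- The underlying linear map. -/
  Q : Alg U →ₗ[ℝ] Alg U
  degree : ∀ (m : ℕ) (a : Alg U), a ∈ algDeg U m → Q a ∈ algDeg U (m + 1)
  leibniz : ∀ (m : ℕ) (a b : Alg U), a ∈ algDeg U m →
    Q (a * b) = Q a * b + (-1 : ℝ) ^ m • (a * Q b)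
  sq_zero : ∀ a : Alg U, Q (Q a) = 0

/-! ### Substituting forms for coordinates -/

/-- The pairing `⟨a, ξ⟩ ∈ ⋀ᵏ (ℝⁿ)*` of a `W⁻ᵏ`-valued alternating `k`-form with a linear form on
`W⁻ᵏ`. -/
def pair {n k : ℕ} (a : E n [⋀^Fin k]→L[ℝ] W k) :
    StrongDual ℝ (W k) →ₗ[ℝ] ⋀[ℝ]^k (Module.Dual ℝ (E n)) where
  toFun ξ := (formEquiv n k).symm (ξ.compContinuousAlternatingMap a)
  map_add' ξ η := by rw [← map_add]; rfl
  map_smul' c ξ := by rw [RingHom.id_apply, ← map_smul]; rfl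

/-- The morphism `S((W^{<0})*) → ⋀ (ℝⁿ)*` with `ξ ↦ ⟨a, ξ⟩`. -/
def evalSym {n : ℕ} (a : ∀ k, E n [⋀^Fin k]→L[ℝ] W k) : GradedSym W →ₐ[ℝ] Lam n :=
  RingQuot.liftAlgHom ℝ
    ⟨TensorAlgebra.lift ℝ (DirectSum.toModule ℝ ℕ (Lam n)
      fun k => (⋀[ℝ]^(k + 1) (Module.Dual ℝ (E n))).subtype ∘ₗ pair (a (k + 1))), by
      rintro _ _ ⟨i, j, ξ, η⟩
      simp only [tgen, map_mul, map_smul, TensorAlgebra.lift_ι_apply, DirectSum.toModule_lof]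
      exact graded_comm (Subtype.mem _) (Subtype.mem _)⟩

/-- Evaluation of smooth functions at a point of `U`. -/
def evalSmooth (U : Opens (W 0)) (u : U) : Smooth U →ₐ[ℝ] ℝ :=
  { ContMDiffMap.evalRingHom u with commutes' := by intro r; rfl }

theorem eval_commute {n : ℕ} (U : Opens (W 0)) (a : ∀ k, E n [⋀^Fin k]→L[ℝ] W k) (u : U)
    (f : Smooth U) (s : GradedSym W) :
    Commute (((Algebra.ofId ℝ (Lam n)).comp (evalSmooth U u)) f) (evalSym a s) :=
  Algebra.commutes (evalSmooth U u f) (evalSym a s)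

/-- The morphism of graded algebras `𝒜_{W|_U} → ⋀ (ℝⁿ)*` determined by
`a ∈ ⨁ₖ ⋀ᵏ (ℝⁿ)* ⊗ W⁻ᵏ` with `0`-form part in `U`: `f ↦ f(a₀)` for `f ∈ C^∞(U)` and
`ξ ↦ ⟨a, ξ⟩` for `ξ ∈ W*`. -/
def evalAlg {n : ℕ} (U : Opens (W 0)) (a : ∀ k, E n [⋀^Fin k]→L[ℝ] W k) (ha : a 0 ![] ∈ U) :
    Alg U →ₐ[ℝ] Lam n :=
  Algebra.TensorProduct.lift ((Algebra.ofId ℝ (Lam n)).comp (evalSmooth U ⟨a 0 ![], ha⟩))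
    (evalSym a) (eval_commute U a ⟨a 0 ![], ha⟩)

/-! ### Forms on `N`, the generalized Maurer–Cartan equation and the Kuranishi transform -/

/-- The underlying data of an element of `Ω(N, W)⁰`: a `W⁻ᵏ`-valued `k`-form for every `k`. Only
the values on `N` are relevant. -/
abbrev Form0 (n : ℕ) (W : ℕ → Type*) [∀ k, NormedAddCommGroup (W k)]
    [∀ k, NormedSpace ℝ (W k)] : Type _ :=
  ∀ k : ℕ, E n → E n [⋀^Fin k]→L[ℝ] W k

/-- The underlying data of an element of `Ω(N, W)¹`: a `W⁻ᵏ`-valued `(k+1)`-form for every `k`. -/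
abbrev Form1 (n : ℕ) (W : ℕ → Type*) [∀ k, NormedAddCommGroup (W k)]
    [∀ k, NormedSpace ℝ (W k)] : Type _ :=
  ∀ k : ℕ, E n → E n [⋀^Fin (k + 1)]→L[ℝ] W k

/-- Smoothness on a subset `N ⊆ ℝⁿ`: on `N` the function agrees with a smooth function defined on
an open neighbourhood of `N`. -/
def SmoothOn {n : ℕ} {F : Type*} [NormedAddCommGroup F] [NormedSpace ℝ F] (N : Set (E n))
    (f : E n → F) : Prop :=
  ∃ (O : Set (E n)) (g : E n → F), IsOpen O ∧ N ⊆ O ∧ ContDiffOn ℝ ∞ g O ∧ Set.EqOn f g N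

/-- `A ∈ Ω(N, W)⁰`. -/
def IsForm0 {n : ℕ} (N : Set (E n)) (A : Form0 n W) : Prop :=
  ∀ k, SmoothOn N (A k)

/-- `A ∈ Ω(N, W|_U)⁰`. -/
def IsForm0In {n : ℕ} (N : Set (E n)) (U : Opens (W 0)) (A : Form0 n W) : Prop :=
  IsForm0 N A ∧ ∀ x ∈ N, A 0 x ![] ∈ U

/-- The exterior derivative on `N`. -/
def dForm {n : ℕ} (N : Set (E n)) (A : Form0 n W) : Form1 n W :=
  fun k x => extDerivWithin (A k) N x

variable [∀ k, FiniteDimensional ℝ (W k)]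

open Classical in
/-- `F_Q(A) ∈ Ω(N, W)¹`, determined at the points of `N` by `⟨F_Q(A), ξ⟩ = (Q ξ)(A)` for all
`ξ ∈ W*`, see `pairing_FQ`. (The value at points where the `0`-form part of `A` is not in `U` is
irrelevant.) -/
def FQ {n : ℕ} {U : Opens (W 0)} (Q : Differential U) (A : Form0 n W) : Form1 n W :=
  fun k x =>
    if hx : A 0 x ![] ∈ U then
      ∑ i, (ContinuousLinearMap.toSpanSingleton ℝ
          (Module.finBasis ℝ (W k) i)).compContinuousAlternatingMap
        (toForm n (k + 1) (evalAlg U (fun j => A j x) hx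
          (Q.Q (coordFn U k (LinearMap.toContinuousLinearMap
            ((Module.finBasis ℝ (W k)).coord i))))))
    else 0

theorem pairing_FQ {n : ℕ} {U : Opens (W 0)} (Q : Differential U) (A : Form0 n W) (k : ℕ)
    (x : E n) (hx : A 0 x ![] ∈ U) (ξ : StrongDual ℝ (W k)) :
    ξ.compContinuousAlternatingMap (FQ Q A k x) =
      toForm n (k + 1) (evalAlg U (fun j => A j x) hx (Q.Q (coordFn U k ξ))) := by
  have hξ : ξ = ∑ i, ξ (Module.finBasis ℝ (W k) i) •
      LinearMap.toContinuousLinearMap ((Module.finBasis ℝ (W k)).coord i) := by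
    ext w
    conv_lhs => rw [← (Module.finBasis ℝ (W k)).sum_repr w, map_sum]
    simp only [map_smul, smul_eq_mul]
    simp [mul_comm]
  conv_rhs => rw [hξ]
  ext v
  simp [FQ, hx, mul_comm]

/-- The de Rham homotopy operator of the contraction `R(x, t) = t x`, the fibre integral of
`i_{∂_t} R^*`: for a `(k+1)`-form `α`,
`(h α)_x(v₁, …, vₖ) = ∫₀¹ α_{tx}(x, t v₁, …, t vₖ) dt = ∫₀¹ tᵏ α_{tx}(x, v₁, …, vₖ) dt`. -/
def hOp {n k : ℕ} {F : Type*} [NormedAddCommGroup F] [NormedSpace ℝ F]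
    (α : E n → E n [⋀^Fin (k + 1)]→L[ℝ] F) : E n → E n [⋀^Fin k]→L[ℝ] F :=
  fun x => ∫ t in (0 : ℝ)..1, t ^ k • (α (t • x)).curryLeft x

/-- `B = A - h(F_Q(A))`. -/
def kuranishi {n : ℕ} {U : Opens (W 0)} (Q : Differential U) (A : Form0 n W) : Form0 n W :=
  fun k x => A k x - hOp (FQ Q A k) x

end Algebra

/-- `N ⊆ ℝⁿ` is an `n`-dimensional submanifold with corners: around each of its points there are
smooth coordinates of `ℝⁿ` in which `N` is given by `yᵢ ≥ 0` for `i` in some set of indices. -/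
def IsSubmanifoldWithCorners {n : ℕ} (N : Set (E n)) : Prop :=
  ∀ x ∈ N, ∃ (φ : OpenPartialHomeomorph (E n) (E n)) (S : Set (Fin n)),
    x ∈ φ.source ∧ ContDiffOn ℝ ∞ φ φ.source ∧ ContDiffOn ℝ ∞ φ.symm φ.target ∧
      ∀ y ∈ φ.source, y ∈ N ↔ ∀ i ∈ S, 0 ≤ φ y i

end GradedMC

end

/-! Let `C = dA - F_Q(A)` be the `curvature`. The radial homotopy satisfies `dh + hd = id` on forms
of positive degree (`extDeriv_integral_add`), hence `dB = C + h(d F_Q(A))` (`extDeriv_kuranishi`).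
The theorem thus says that `C = 0` if and only if `C + h(d F_Q(A)) = 0`.

The link is a Bianchi identity. The `defect` `D(F) = d(F(A)) - (QF)(A)` is a graded derivation along
`F ↦ F(A)`, and on a linear coordinate `ξ` it equals `⟨C, ξ⟩`. By Hadamard's lemma its value at `f ∈
C^∞(U)` is its value at the linear form `df`, so `D` is determined by `C` and bounded by it on
compact sets (`exists_defect_bound`). Since `Q² = 0`, `d((Qξ)(A)) = D(Qξ)`, so `d F_Q(A)` is bounded
by a multiple of `C`.

If `C = 0`, then `d F_Q(A) = 0` and `dB = 0`. If `dB = 0`, then `C = -h(d F_Q(A))`; on the segment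
from `0` to `x` this gives `|C(sx)| ≤ M ∫₀ˢ |C(tx)| dt`, and Gronwall forces `C = 0`
(`curvature_eq_zero`).

The analysis takes place on an open star-shaped neighbourhood of `N` to which `A` extends; `N` has
unique derivatives, so the extension does not affect the derivatives on `N`. -/

noncomputable section

namespace GradedMC

open scoped Manifold ContDiff TensorProduct DirectSum
open TopologicalSpace

/-! ### Smooth dependence of integrals over `[0,1]` on a parameter. -/

section ParametricIntegral

universe u v

open Set Filter Topology MeasureTheory

theorem continuousOn_slice {Z G : Type*} [TopologicalSpace Z] [TopologicalSpace G]
    {V : Set (Z × ℝ)} {y : Z}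
    (hy : ∀ t ∈ Icc (0 : ℝ) 1, (y, t) ∈ V) {g : Z × ℝ → G} (hg : ContinuousOn g V) :
    ContinuousOn (fun t : ℝ => g (y, t)) (Icc 0 1) :=
  hg.comp (by fun_prop) hy

variable {X : Type u} [NormedAddCommGroup X] [NormedSpace ℝ X]

/-- The partial derivative in the first variable of a function on `X × ℝ`. -/
def partialFst {F : Type*} [NormedAddCommGroup F] [NormedSpace ℝ F] (f : X × ℝ → F) (p : X × ℝ) :
    X →L[ℝ] F :=
  (fderiv ℝ f p).comp (ContinuousLinearMap.inl ℝ X ℝ)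

theorem contDiffOn_partialFst {F : Type*} [NormedAddCommGroup F] [NormedSpace ℝ F]
    {f : X × ℝ → F} {V : Set (X × ℝ)} (hV : IsOpen V) (hf : ContDiffOn ℝ ∞ f V) :
    ContDiffOn ℝ ∞ (partialFst f) V :=
  ((contDiffOn_infty_iff_fderiv_of_isOpen hV).1 hf).2.clm_comp contDiffOn_const

theorem hasFDerivAt_integral_of_contDiffOn {F : Type*} [NormedAddCommGroup F] [NormedSpace ℝ F]
    {f : X × ℝ → F} {V : Set (X × ℝ)} (hV : IsOpen V) (hf : ContDiffOn ℝ ∞ f V) {x : X}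
    (hx : ∀ t ∈ Icc (0 : ℝ) 1, (x, t) ∈ V) :
    HasFDerivAt (fun x => ∫ t in (0 : ℝ)..1, f (x, t))
      (∫ t in (0 : ℝ)..1, partialFst f (x, t)) x := by
  have hp := (contDiffOn_partialFst hV hf).continuousOn
  have hdiff : ∀ p ∈ V, HasFDerivAt (fun y => f (y, p.2)) (partialFst f p) p.1 := by
    intro p hpV
    have h1 : HasFDerivAt f (fderiv ℝ f p) (p.1, p.2) :=
      ((hf.differentiableOn (by simp)).differentiableAt (hV.mem_nhds hpV)).hasFDerivAt
    exact h1.comp p.1 (hasFDerivAt_prodMk_left p.1 p.2)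
  obtain ⟨M, hM⟩ := isCompact_Icc.exists_bound_of_continuousOn (continuousOn_slice hx hp)
  have hopen : IsOpen (V ∩ (fun p => ‖partialFst f p‖) ⁻¹' Iio (M + 1)) :=
    hp.norm.isOpen_inter_preimage hV isOpen_Iio
  -- Compactness of `[0,1]` gives one neighbourhood of `x` on which the partial derivative is below
  -- `M + 1` for all `t`: the dominating constant.
  obtain ⟨A, B, hA, -, hxA, hB, hAB⟩ := generalized_tube_lemma (isCompact_singleton (x := x))
    (isCompact_Icc (a := (0 : ℝ)) (b := 1)) hopen (by
      rintro ⟨y, t⟩ ⟨rfl : y = x, ht⟩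
      exact ⟨hx t ht, lt_of_le_of_lt (hM t ht) (lt_add_one M)⟩)
  have hI : uIoc (0 : ℝ) 1 ⊆ Icc 0 1 := by
    rw [uIoc_of_le zero_le_one]; exact Ioc_subset_Icc_self
  have hAx : A ∈ 𝓝 x := hA.mem_nhds (hxA rfl)
  refine intervalIntegral.hasFDerivAt_integral_of_dominated_of_fderiv_le
    (F := fun x t => f (x, t)) (F' := fun x t => partialFst f (x, t)) (bound := fun _ => M + 1)
    hAx ?_ ?_ ?_ ?_ ?_ ?_
  · filter_upwards [hAx] with y hy
    exact ((continuousOn_slice (fun t ht => (hAB ⟨hy, hB ht⟩).1) hf.continuousOn).mono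
      hI).aestronglyMeasurable measurableSet_uIoc
  · refine ContinuousOn.intervalIntegrable ?_
    rw [uIcc_of_le zero_le_one]
    exact continuousOn_slice hx hf.continuousOn
  · exact ((continuousOn_slice hx hp).mono hI).aestronglyMeasurable measurableSet_uIoc
  · refine Eventually.of_forall fun t ht y hy => ?_
    exact (hAB ⟨hy, hB (hI ht)⟩).2.le
  · simp
  · refine Eventually.of_forall fun t ht y hy => ?_
    exact hdiff (y, t) (hAB ⟨hy, hB (hI ht)⟩).1

/-- The induction passes from `F` to `X →L[ℝ] F`, so `F` must range over a universe closed under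
this operation; hence `max u v`. -/
theorem contDiffOn_nat_integral {V : Set (X × ℝ)} (hV : IsOpen V) {O : Set X} (hO : IsOpen O)
    (hOV : ∀ x ∈ O, ∀ t ∈ Icc (0 : ℝ) 1, (x, t) ∈ V) (m : ℕ) :
    ∀ {F : Type max u v} [NormedAddCommGroup F] [NormedSpace ℝ F] {f : X × ℝ → F},
      ContDiffOn ℝ ∞ f V → ContDiffOn ℝ m (fun x => ∫ t in (0 : ℝ)..1, f (x, t)) O := by
  induction m with
  | zero =>
    intro F _ _ f hf
    exact contDiffOn_zero.2 fun x hx =>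
      (hasFDerivAt_integral_of_contDiffOn hV hf (hOV x hx)).continuousAt.continuousWithinAt
  | succ m ih =>
    intro F _ _ f hf
    rw [Nat.cast_succ, contDiffOn_succ_iff_fderiv_of_isOpen hO]
    refine ⟨fun x hx => (hasFDerivAt_integral_of_contDiffOn hV hf
      (hOV x hx)).differentiableAt.differentiableWithinAt, by simp, ?_⟩
    exact (ih (contDiffOn_partialFst hV hf)).congr fun x hx =>
      (hasFDerivAt_integral_of_contDiffOn hV hf (hOV x hx)).fderiv

theorem contDiffOn_integral {V : Set (X × ℝ)} (hV : IsOpen V) {O : Set X} (hO : IsOpen O)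
    (hOV : ∀ x ∈ O, ∀ t ∈ Icc (0 : ℝ) 1, (x, t) ∈ V)
    {F : Type max u v} [NormedAddCommGroup F] [NormedSpace ℝ F] {f : X × ℝ → F}
    (hf : ContDiffOn ℝ ∞ f V) : ContDiffOn ℝ ∞ (fun x => ∫ t in (0 : ℝ)..1, f (x, t)) O :=
  contDiffOn_infty.2 fun m => contDiffOn_nat_integral.{u, v} hV hO hOV m hf

end ParametricIntegral

/-! ### The Poincaré homotopy formula for the radial contraction. -/

section HomotopyFormula

open Set ContinuousAlternatingMap

variable {X : Type*} [NormedAddCommGroup X] [NormedSpace ℝ X]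
  {F : Type*} [NormedAddCommGroup F] [NormedSpace ℝ F]

/-- Alternation anticommutes with contraction by a vector, up to the evaluation of the
derivative at this vector. -/
theorem alternatizeUncurryFin_contract_add {k : ℕ} (D : X →L[ℝ] X [⋀^Fin (k + 1)]→L[ℝ] F)
    (D' : X →L[ℝ] X [⋀^Fin k]→L[ℝ] F) (x : X) (hD' : ∀ v, D' v = (D v).curryLeft x) :
    alternatizeUncurryFin D' + (alternatizeUncurryFin D).curryLeft x = D x := by
  ext v
  simp only [ContinuousAlternatingMap.add_apply, alternatizeUncurryFin_apply, curryLeft_apply_apply, hD',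
    Fin.sum_univ_succ (n := k + 1)]
  have h0 : Fin.removeNth 0 (Matrix.vecCons x v) = v := by
    ext i; simp [Fin.removeNth]
  have h1 : ∀ i : Fin (k + 1), Fin.removeNth i.succ (Matrix.vecCons x v) =
      Matrix.vecCons x (Fin.removeNth i v) := by
    intro i
    ext j
    refine Fin.cases ?_ (fun j => ?_) j <;> simp [Fin.removeNth]
  -- The term of index `0` is `D x`; those of index `i + 1` carry the opposite sign and cancel the
  -- alternation of `D'`.
  simp [h0, h1, pow_succ]

/-- `curryLeft` as a continuous linear map. -/
def curryLeftCLM (k : ℕ) (X F : Type*) [NormedAddCommGroup X] [NormedSpace ℝ X]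
    [NormedAddCommGroup F] [NormedSpace ℝ F] :
    (X [⋀^Fin (k + 1)]→L[ℝ] F) →L[ℝ] X →L[ℝ] X [⋀^Fin k]→L[ℝ] F :=
  (curryLeftLI (𝕜 := ℝ) (E := X) (F := F) (n := k)).toContinuousLinearMap

/-- The contraction of forms with a vector, as a continuous linear map. -/
def contract (k : ℕ) (F : Type*) [NormedAddCommGroup F] [NormedSpace ℝ F] (x : X) :
    (X [⋀^Fin (k + 1)]→L[ℝ] F) →L[ℝ] X [⋀^Fin k]→L[ℝ] F :=
  (ContinuousLinearMap.apply ℝ (X [⋀^Fin k]→L[ℝ] F) x).comp (curryLeftCLM k X F)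

theorem contract_apply {k : ℕ} (x : X) (β : X [⋀^Fin (k + 1)]→L[ℝ] F) :
    contract k F x β = β.curryLeft x := rfl

/-- The integrand of the homotopy operator. -/
def hIntegrand {k : ℕ} (α : X → X [⋀^Fin (k + 1)]→L[ℝ] F) (p : X × ℝ) : X [⋀^Fin k]→L[ℝ] F :=
  p.2 ^ k • (α (p.2 • p.1)).curryLeft p.1

variable {O : Set X} {k : ℕ} {α : X → X [⋀^Fin (k + 1)]→L[ℝ] F}

theorem contDiffOn_hIntegrand (hα : ContDiffOn ℝ ∞ α O) :
    ContDiffOn ℝ ∞ (hIntegrand α) {p : X × ℝ | p.2 • p.1 ∈ O} := by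
  have h1 : ContDiffOn ℝ ∞ (fun p : X × ℝ => α (p.2 • p.1)) {p : X × ℝ | p.2 • p.1 ∈ O} :=
    hα.comp (contDiff_snd.smul contDiff_fst).contDiffOn fun p hp => hp
  have h2 : ContDiffOn ℝ ∞ (fun p : X × ℝ => curryLeftCLM k X F (α (p.2 • p.1)))
      {p : X × ℝ | p.2 • p.1 ∈ O} :=
    ContDiff.comp_contDiffOn (g := curryLeftCLM k X F) (by fun_prop) h1
  exact (contDiff_snd.pow k).contDiffOn.smul (h2.clm_apply contDiff_fst.contDiffOn)

theorem partialFst_hIntegrand (hO : IsOpen O) (hα : ContDiffOn ℝ ∞ α O) {x : X} {t : ℝ}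
    (hx : t • x ∈ O) :
    partialFst (hIntegrand α) (x, t) = t ^ (k + 1) • (contract k F x).comp (fderiv ℝ α (t • x)) +
      t ^ k • (α (t • x)).curryLeft := by
  have hopen : IsOpen {p : X × ℝ | p.2 • p.1 ∈ O} := hO.preimage (by fun_prop)
  have hd : HasFDerivAt (hIntegrand α) (fderiv ℝ (hIntegrand α) (x, t)) (x, t) :=
    (((contDiffOn_hIntegrand hα).differentiableOn (by simp)).differentiableAt
      (hopen.mem_nhds hx)).hasFDerivAt
  have h1 : HasFDerivAt (fun y => hIntegrand α (y, t)) (partialFst (hIntegrand α) (x, t)) x :=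
    HasFDerivAt.comp x (f := fun y : X => (y, t)) hd (hasFDerivAt_prodMk_left x t)
  have hα' : HasFDerivAt α (fderiv ℝ α (t • x)) (t • x) :=
    ((hα.differentiableOn (by simp)).differentiableAt (hO.mem_nhds hx)).hasFDerivAt
  have h2 : HasFDerivAt (fun y : X => α (t • y)) _ x :=
    hα'.comp x ((hasFDerivAt_id x).const_smul t)
  have h3 : HasFDerivAt (fun y : X => curryLeftCLM k X F (α (t • y))) _ x :=
    HasFDerivAt.comp x (g := curryLeftCLM k X F) (g' := curryLeftCLM k X F)
      (ContinuousLinearMap.hasFDerivAt _) h2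
  have h4 := (h3.clm_apply (hasFDerivAt_id x)).const_smul (t ^ k)
  refine (h1.unique h4).trans ?_
  ext v w
  simp [contract_apply, curryLeftCLM, pow_succ, mul_smul, add_comm]

theorem hasFDerivAt_integral_hIntegrand (hO : IsOpen O) (hα : ContDiffOn ℝ ∞ α O) {x : X}
    (hx : ∀ t ∈ Icc (0 : ℝ) 1, t • x ∈ O) :
    HasFDerivAt (fun x => ∫ t in (0 : ℝ)..1, hIntegrand α (x, t))
      (∫ t in (0 : ℝ)..1, partialFst (hIntegrand α) (x, t)) x :=
  hasFDerivAt_integral_of_contDiffOn (hO.preimage (by fun_prop)) (contDiffOn_hIntegrand hα) hx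

theorem contDiffOn_extDeriv {k : ℕ} {α : X → X [⋀^Fin k]→L[ℝ] F} (hO : IsOpen O)
    (hα : ContDiffOn ℝ ∞ α O) :
    ContDiffOn ℝ ∞ (extDeriv α) O :=
  ContDiff.comp_contDiffOn (g := alternatizeUncurryFinCLM (n := k) ℝ X F) (by fun_prop)
    ((contDiffOn_infty_iff_fderiv_of_isOpen hO).1 hα).2

/-- The homotopy formula `d h + h d = id` for forms of positive degree. -/
theorem extDeriv_integral_add [CompleteSpace F] (hO : IsOpen O) (hα : ContDiffOn ℝ ∞ α O) {x : X}
    (hx : ∀ t ∈ Icc (0 : ℝ) 1, t • x ∈ O) :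
    extDeriv (fun x => ∫ t in (0 : ℝ)..1, hIntegrand α (x, t)) x +
      ∫ t in (0 : ℝ)..1, hIntegrand (extDeriv α) (x, t) = α x := by
  have hopen : IsOpen {p : X × ℝ | p.2 • p.1 ∈ O} := hO.preimage (by fun_prop)
  have hc1 : ContinuousOn (fun t : ℝ => partialFst (hIntegrand α) (x, t)) (Icc 0 1) :=
    continuousOn_slice hx (contDiffOn_partialFst hopen (contDiffOn_hIntegrand hα)).continuousOn
  have hc2 : ContinuousOn (fun t : ℝ => hIntegrand (extDeriv α) (x, t)) (Icc 0 1) :=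
    continuousOn_slice hx (contDiffOn_hIntegrand (contDiffOn_extDeriv hO hα)).continuousOn
  have hc3 : ContinuousOn (fun t : ℝ => alternatizeUncurryFinCLM ℝ X F
      (partialFst (hIntegrand α) (x, t))) (Icc 0 1) :=
    (alternatizeUncurryFinCLM ℝ X F).continuous.comp_continuousOn hc1
  rw [extDeriv, (hasFDerivAt_integral_hIntegrand hO hα hx).fderiv,
    ← alternatizeUncurryFinCLM_apply,
    ← ContinuousLinearMap.intervalIntegral_comp_comm _ (hc1.intervalIntegrable_of_Icc zero_le_one),
    ← intervalIntegral.integral_add (hc3.intervalIntegrable_of_Icc zero_le_one)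
      (hc2.intervalIntegrable_of_Icc zero_le_one)]
  -- The integrand of `dh + hd` is the derivative of `t ^ (k + 1) • α (t • x)`, which is `α x` at `t
  -- = 1` and vanishes at `t = 0` because the degree is positive.
  have hderiv : ∀ t ∈ uIcc (0 : ℝ) 1, HasDerivAt (fun t : ℝ => t ^ (k + 1) • α (t • x))
      (alternatizeUncurryFinCLM ℝ X F (partialFst (hIntegrand α) (x, t)) +
        hIntegrand (extDeriv α) (x, t)) t := by
    intro t ht
    rw [uIcc_of_le zero_le_one] at ht
    have hα' : HasFDerivAt α (fderiv ℝ α (t • x)) (t • x) :=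
      ((hα.differentiableOn (by simp)).differentiableAt (hO.mem_nhds (hx t ht))).hasFDerivAt
    have h2 := hα'.comp_hasDerivAt t ((hasDerivAt_id t).smul_const x)
    refine ((hasDerivAt_pow (k + 1) t).smul h2).congr_deriv ?_
    rw [partialFst_hIntegrand hO hα (hx t ht), alternatizeUncurryFinCLM_apply, alternatizeUncurryFin_add,
      alternatizeUncurryFin_smul, alternatizeUncurryFin_smul,
      alternatizeUncurryFin_curryLeft]
    have h3 := alternatizeUncurryFin_contract_add (fderiv ℝ α (t • x))
      ((contract k F x).comp (fderiv ℝ α (t • x))) x fun v => rfl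
    simp only [hIntegrand, extDeriv]
    rw [← eq_sub_iff_add_eq] at h3
    rw [h3, ← Nat.cast_smul_eq_nsmul ℝ, smul_smul]
    simp only [id, Function.comp, one_smul, smul_sub, Nat.add_sub_cancel]
    push_cast
    rw [mul_comm (t ^ k)]
    abel
  rw [intervalIntegral.integral_eq_sub_of_hasDerivAt hderiv
    ((hc3.add hc2).intervalIntegrable_of_Icc zero_le_one)]
  simp

end HomotopyFormula

/-! ### Exterior derivative in the algebra `⋀ (ℝⁿ)*`. -/

section ExteriorCalculus

open ContinuousAlternatingMap

variable {n : ℕ}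

theorem exteriorPower_one : ⋀[ℝ]^1 (Module.Dual ℝ (E n)) =
    LinearMap.range (ExteriorAlgebra.ι ℝ (M := Module.Dual ℝ (E n))) :=
  pow_one _

theorem exteriorPower_eq_bot {k : ℕ} (hk : n < k) : ⋀[ℝ]^k (Module.Dual ℝ (E n)) = ⊥ := by
  rw [← Submodule.finrank_eq_zero (R := ℝ), exteriorPower.finrank_eq, Subspace.dual_finrank_eq,
    finrank_euclideanSpace_fin, Nat.choose_eq_zero_of_lt hk]

/-- Only the degrees up to `n` contribute. Finite dimension gives the algebra a norm for which all
linear maps are continuous. -/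
instance finiteDimensional_Lam : FiniteDimensional ℝ (Lam n) := by
  have h : (⨆ k ∈ Finset.range (n + 1), ⋀[ℝ]^k (Module.Dual ℝ (E n))) = ⊤ := by
    rw [eq_top_iff, ← (DirectSum.Decomposition.isInternal
      fun k : ℕ => ⋀[ℝ]^k (Module.Dual ℝ (E n))).submodule_iSup_eq_top]
    refine iSup_le fun k => ?_
    by_cases hk : k < n + 1
    · exact le_iSup₂_of_le k (Finset.mem_range.2 hk) le_rfl
    · rw [exteriorPower_eq_bot (by omega)]
      exact bot_le
  have h2 : FiniteDimensional ℝ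
      ↥(⨆ k ∈ Finset.range (n + 1), ⋀[ℝ]^k (Module.Dual ℝ (E n))) := by
    rw [← Finset.sup_eq_iSup]
    exact Submodule.finiteDimensional_finset_sup _ _
  rw [h] at h2
  exact Module.finite_def.2 ((Submodule.fg_top _).1 h2.fg_top)

/-- The norm on `⋀ (ℝⁿ)*` given by a basis. -/
instance normedAddCommGroupLam : NormedAddCommGroup (Lam n) :=
  NormedAddCommGroup.induced (Lam n) (Fin (Module.finrank ℝ (Lam n)) → ℝ)
    (Module.finBasis ℝ (Lam n)).equivFun (Module.finBasis ℝ (Lam n)).equivFun.injective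

instance normedSpaceLam : NormedSpace ℝ (Lam n) :=
  NormedSpace.induced ℝ (Lam n) (Fin (Module.finrank ℝ (Lam n)) → ℝ)
    (Module.finBasis ℝ (Lam n)).equivFun

/-- The multiplication of `⋀ (ℝⁿ)*` as a continuous bilinear map. -/
def mulCLM (n : ℕ) : Lam n →L[ℝ] Lam n →L[ℝ] Lam n :=
  LinearMap.toContinuousLinearMap
    (LinearMap.toContinuousLinearMap.toLinearMap ∘ₗ LinearMap.mul ℝ (Lam n))

theorem mulCLM_apply (a b : Lam n) : mulCLM n a b = a * b := rfl

/-- The covector `dxᵢ`. -/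
def dx (i : Fin n) : Lam n := ExteriorAlgebra.ι ℝ ((stdBasis n).coord i)

/-- The exterior derivative of a function with values in `⋀ (ℝⁿ)*`. -/
def dLam (θ : E n → Lam n) (x : E n) : Lam n :=
  ∑ i, dx i * fderiv ℝ θ x (stdBasis n i)

theorem dx_mul {m : ℕ} (i : Fin n) {a : Lam n} (ha : a ∈ ⋀[ℝ]^m (Module.Dual ℝ (E n))) :
    dx i * a = (-1 : ℝ) ^ m • (a * dx i) := by
  have h : dx i ∈ ⋀[ℝ]^1 (Module.Dual ℝ (E n)) := by
    rw [exteriorPower_one]; exact ⟨_, rfl⟩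
  simpa using graded_comm h ha

/-- Each `dx i` is moved past the value `θ x` only, never past a derivative of `θ`, so homogeneity
is needed just at the point `x`. -/
theorem dLam_mul {m : ℕ} {θ η : E n → Lam n} {x : E n} (hθ : DifferentiableAt ℝ θ x)
    (hη : DifferentiableAt ℝ η x) (hm : θ x ∈ ⋀[ℝ]^m (Module.Dual ℝ (E n))) :
    dLam (fun y => θ y * η y) x = dLam θ x * η x + (-1 : ℝ) ^ m • (θ x * dLam η x) := by
  have h : HasFDerivAt (fun y => θ y * η y) _ x :=
    (mulCLM n).hasFDerivAt_of_bilinear hθ.hasFDerivAt hη.hasFDerivAt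
  simp only [dLam, h.fderiv, Finset.sum_mul, Finset.mul_sum, Finset.smul_sum,
    ← Finset.sum_add_distrib]
  refine Finset.sum_congr rfl fun i _ => ?_
  simp only [_root_.add_apply, ContinuousLinearMap.precompR_apply,
    ContinuousLinearMap.precompL_apply, ContinuousLinearMap.compL_apply,
    ContinuousLinearMap.comp_apply, mulCLM_apply, mul_add]
  rw [← mul_assoc, dx_mul i hm, add_comm, mul_assoc, smul_mul_assoc, mul_assoc]

theorem dLam_add {θ η : E n → Lam n} {x : E n} (hθ : DifferentiableAt ℝ θ x)
    (hη : DifferentiableAt ℝ η x) : dLam (fun y => θ y + η y) x = dLam θ x + dLam η x := by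
  simp [dLam, fderiv_fun_add hθ hη, mul_add, Finset.sum_add_distrib]

theorem dLam_smul {θ : E n → Lam n} {x : E n} (c : ℝ) (hθ : DifferentiableAt ℝ θ x) :
    dLam (fun y => c • θ y) x = c • dLam θ x := by
  simp [dLam, fderiv_fun_const_smul hθ, Finset.smul_sum]

theorem toForm_coe {k : ℕ} (a : ⋀[ℝ]^k (Module.Dual ℝ (E n))) :
    toForm n k (a : Lam n) = formEquiv n k a := by
  simp only [toForm, LinearMap.comp_apply, LinearEquiv.coe_coe,
    DirectSum.decomposeLinearEquiv_apply, DirectSum.decompose_coe]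
  rw [← DirectSum.apply_eq_component, DirectSum.of_eq_same]

theorem toForm_coe_of_ne {k m : ℕ} (h : m ≠ k) (a : ⋀[ℝ]^m (Module.Dual ℝ (E n))) :
    toForm n k (a : Lam n) = 0 := by
  simp only [toForm, LinearMap.comp_apply, LinearEquiv.coe_coe,
    DirectSum.decomposeLinearEquiv_apply, DirectSum.decompose_coe]
  rw [← DirectSum.apply_eq_component, DirectSum.of_eq_of_ne _ _ _ h.symm, _root_.map_zero]

/-- `toForm` as a continuous linear map. -/
def toFormCLM (n k : ℕ) : Lam n →L[ℝ] E n [⋀^Fin k]→L[ℝ] ℝ :=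
  LinearMap.toContinuousLinearMap (toForm n k)

theorem toForm_ιMulti {k : ℕ} (φ : Fin k → Module.Dual ℝ (E n)) (v : Fin k → E n) :
    toForm n k (ExteriorAlgebra.ιMulti ℝ k φ) v = (Matrix.of fun i j => φ j (v i)).det := by
  rw [← exteriorPower.ιMulti_apply_coe, toForm_coe]
  exact toAlt_ιMulti φ v

theorem toForm_ιMulti_of_ne {k m : ℕ} (h : m ≠ k) (φ : Fin m → Module.Dual ℝ (E n)) :
    toForm n k (ExteriorAlgebra.ιMulti ℝ m φ) = 0 := by
  rw [← exteriorPower.ιMulti_apply_coe, toForm_coe_of_ne h]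

/-- On a wedge of covectors this is the Laplace expansion of a determinant along its first column;
such wedges span the algebra. -/
theorem toForm_dx_mul {k : ℕ} (i : Fin n) (a : Lam n) :
    toForm n (k + 1) (dx i * a) =
      alternatizeUncurryFin (ContinuousLinearMap.smulRight
        (LinearMap.toContinuousLinearMap ((stdBasis n).coord i)) (toForm n k a)) := by
  have ha : a ∈ Submodule.span ℝ (Set.range fun x : Σ m, (Fin m → Module.Dual ℝ (E n)) =>
      ExteriorAlgebra.ιMulti ℝ x.1 x.2) := by
    rw [ExteriorAlgebra.ιMulti_span]; trivial
  induction ha using Submodule.span_induction with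
  | mem a ha =>
    obtain ⟨⟨m, φ⟩, rfl⟩ := ha
    have h : dx i * ExteriorAlgebra.ιMulti ℝ m φ =
        ExteriorAlgebra.ιMulti ℝ (m + 1) (Matrix.vecCons ((stdBasis n).coord i) φ) := by
      rw [ExteriorAlgebra.ιMulti_succ_apply]
      rfl
    simp only [h]
    rcases eq_or_ne m k with rfl | hmk
    · ext v
      rw [toForm_ιMulti, Matrix.det_succ_column_zero, alternatizeUncurryFin_apply]
      refine Finset.sum_congr rfl fun j _ => ?_
      simp only [ContinuousLinearMap.smulRight_apply, ContinuousAlternatingMap.smul_apply,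
        toForm_ιMulti, Matrix.of_apply, Matrix.cons_val_zero, smul_eq_mul, zsmul_eq_mul]
      push_cast
      rw [mul_assoc]
      rfl
    · rw [toForm_ιMulti_of_ne hmk, toForm_ιMulti_of_ne (by omega)]
      ext v
      simp [alternatizeUncurryFin_apply]
  | zero =>
    ext v
    simp [alternatizeUncurryFin_apply]
  | add a b _ _ ha hb =>
    rw [mul_add, map_add, ha, hb, ← alternatizeUncurryFin_add, map_add]
    congr 1
    ext v w
    simp
  | smul c a _ ha =>
    rw [mul_smul_comm, map_smul, ha, map_smul, ← alternatizeUncurryFin_smul]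
    congr 1
    ext v w
    simp [mul_left_comm]

theorem toForm_dLam {k : ℕ} {θ : E n → Lam n} {x : E n} (hθ : DifferentiableAt ℝ θ x) :
    toForm n (k + 1) (dLam θ x) = extDeriv (fun y => toForm n k (θ y)) x := by
  have h : HasFDerivAt (fun y => toForm n k (θ y)) ((toFormCLM n k).comp (fderiv ℝ θ x)) x :=
    HasFDerivAt.comp x (g := toFormCLM n k) (g' := toFormCLM n k)
      (ContinuousLinearMap.hasFDerivAt _) hθ.hasFDerivAt
  rw [extDeriv, h.fderiv, dLam, _root_.map_sum]
  simp only [toForm_dx_mul, ← alternatizeUncurryFinCLM_apply]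
  rw [← _root_.map_sum]
  congr 1
  ext v w
  have hv : v = ∑ i, (stdBasis n).coord i v • stdBasis n i :=
    ((stdBasis n).sum_repr v).symm
  conv_rhs => rw [hv, _root_.map_sum]
  simp [toFormCLM]

end ExteriorCalculus

/-! ### Hadamard's lemma and point derivations of `C^∞(U)`. -/

section PointDerivation

universe u

open Set Metric

variable {Y : Type u} [NormedAddCommGroup Y] [NormedSpace ℝ Y] {U : Opens Y}

open Classical in
/-- The extension by zero of a smooth function on `U`. -/
def extendZero (f : C^∞⟮𝓘(ℝ, Y), U; 𝓘(ℝ, ℝ), ℝ⟯) (y : Y) : ℝ :=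
  if hy : y ∈ U then f ⟨y, hy⟩ else 0

theorem extendZero_of_mem (f : C^∞⟮𝓘(ℝ, Y), U; 𝓘(ℝ, ℝ), ℝ⟯) {y : Y} (hy : y ∈ U) :
    extendZero f y = f ⟨y, hy⟩ := dif_pos hy

theorem contDiffOn_extendZero (f : C^∞⟮𝓘(ℝ, Y), U; 𝓘(ℝ, ℝ), ℝ⟯) :
    ContDiffOn ℝ ∞ (extendZero f) U := by
  intro y hy
  refine ContDiffAt.contDiffWithinAt ?_
  have h1 : ContMDiffAt 𝓘(ℝ, Y) 𝓘(ℝ, ℝ) ∞ (fun x : U => extendZero f x) ⟨y, hy⟩ := by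
    have h2 : (fun x : U => extendZero f x) = f := funext fun x => extendZero_of_mem f x.2
    rw [h2]
    exact f.contMDiff _
  exact contMDiffAt_iff_contDiffAt.1 (contMDiffAt_subtype_iff.1 h1)

/-- The restriction of a smooth function to `U`. -/
def restrictSmooth (U : Opens Y) (F : Y → ℝ) (hF : ContDiffOn ℝ ∞ F U) :
    C^∞⟮𝓘(ℝ, Y), U; 𝓘(ℝ, ℝ), ℝ⟯ :=
  ⟨fun x => F x, fun x => contMDiffAt_subtype_iff.2
    (contMDiffAt_iff_contDiffAt.2 ((hF x x.2).contDiffAt (U.isOpen.mem_nhds x.2)))⟩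

/-- The mean value form of Hadamard's lemma on a ball. -/
theorem exists_smooth_fderiv_mean [CompleteSpace Y] {F : Y → ℝ} {u : Y} {r : ℝ}
    (hF : ContDiffOn ℝ ∞ F (ball u r)) :
    ∃ G : Y → StrongDual ℝ Y, ContDiffOn ℝ ∞ G (ball u r) ∧ G u = fderiv ℝ F u ∧
      ∀ y ∈ ball u r, F y = F u + G y (y - u) := by
  have hseg : ∀ y ∈ ball u r, ∀ t ∈ Icc (0 : ℝ) 1, u + t • (y - u) ∈ ball u r := by
    intro y hy t ht
    have hu : u ∈ ball u r := mem_ball_self (pos_of_mem_ball hy)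
    exact (convex_ball u r).add_smul_sub_mem hu hy ht
  have hdF := ((contDiffOn_infty_iff_fderiv_of_isOpen isOpen_ball).1 hF).2
  have hV : IsOpen {p : Y × ℝ | u + p.2 • (p.1 - u) ∈ ball u r} :=
    isOpen_ball.preimage (by fun_prop)
  have hf : ContDiffOn ℝ ∞ (fun p : Y × ℝ => fderiv ℝ F (u + p.2 • (p.1 - u)))
      {p : Y × ℝ | u + p.2 • (p.1 - u) ∈ ball u r} :=
    hdF.comp (contDiff_const.add (contDiff_snd.smul
      (contDiff_fst.sub contDiff_const))).contDiffOn fun p hp => hp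
  refine ⟨fun y => ∫ t in (0 : ℝ)..1, fderiv ℝ F (u + t • (y - u)),
    contDiffOn_integral.{u, u} hV isOpen_ball hseg hf, by simp, fun y hy => ?_⟩
  have hc : ContinuousOn (fun t : ℝ => fderiv ℝ F (u + t • (y - u))) (Icc 0 1) :=
    continuousOn_slice (hseg y hy) hf.continuousOn
  have hc' : ContinuousOn (fun t : ℝ => fderiv ℝ F (u + t • (y - u)) (y - u)) (Icc 0 1) :=
    hc.clm_apply continuousOn_const
  have hderiv : ∀ t ∈ uIcc (0 : ℝ) 1, HasDerivAt (fun t : ℝ => F (u + t • (y - u)))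
      (fderiv ℝ F (u + t • (y - u)) (y - u)) t := by
    intro t ht
    rw [uIcc_of_le zero_le_one] at ht
    have h1 : HasFDerivAt F (fderiv ℝ F (u + t • (y - u))) (u + t • (y - u)) :=
      ((hF.differentiableOn (by simp)).differentiableAt
        (isOpen_ball.mem_nhds (hseg y hy t ht))).hasFDerivAt
    have h2 : HasDerivAt (fun t : ℝ => u + t • (y - u)) (y - u) t := by
      simpa using ((hasDerivAt_id t).smul_const (y - u)).const_add u
    exact h1.comp_hasDerivAt t h2
  have h3 := intervalIntegral.integral_eq_sub_of_hasDerivAt hderiv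
    (hc'.intervalIntegrable_of_Icc zero_le_one)
  rw [ContinuousLinearMap.intervalIntegral_apply (hc.intervalIntegrable_of_Icc zero_le_one), h3]
  simp

theorem contDiff_bump_mul [FiniteDimensional ℝ Y] {u : Y} (χ : ContDiffBump u) {r : ℝ}
    (hr : χ.rOut < r) {g : Y → ℝ} (hg : ContDiffOn ℝ ∞ g (ball u r)) :
    ContDiff ℝ ∞ fun y => χ y * g y := by
  rw [contDiff_iff_contDiffAt]
  intro y
  by_cases hy : y ∈ ball u r
  · exact χ.contDiffAt.mul (hg.contDiffAt (isOpen_ball.mem_nhds hy))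
  · have hy' : y ∈ (closedBall u χ.rOut)ᶜ := fun h => hy (lt_of_le_of_lt h hr)
    refine (contDiffAt_const (c := (0 : ℝ))).congr_of_eventuallyEq ?_
    filter_upwards [isClosed_closedBall.isOpen_compl.mem_nhds hy'] with z hz
    have hz' : χ z = 0 := χ.zero_of_le_dist (le_of_lt (not_le.1 hz))
    rw [hz', zero_mul]

variable {V : Type*} [AddCommGroup V] [Module ℝ V]

theorem pointDerivation_one {u : U} {v : C^∞⟮𝓘(ℝ, Y), U; 𝓘(ℝ, ℝ), ℝ⟯ →ₗ[ℝ] V}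
    (hv : ∀ f g, v (f * g) = f u • v g + g u • v f) : v 1 = 0 := by
  have h := hv 1 1
  simpa using h

/-- By Hadamard's lemma a function vanishing to first order at `u` is, after cutting off, a sum of
products of functions vanishing at `u`, and a point derivation kills such products. -/
theorem pointDerivation_eq_zero [FiniteDimensional ℝ Y] {u : U} {v : C^∞⟮𝓘(ℝ, Y), U; 𝓘(ℝ, ℝ), ℝ⟯ →ₗ[ℝ] V}
    (hv : ∀ f g, v (f * g) = f u • v g + g u • v f) {f : C^∞⟮𝓘(ℝ, Y), U; 𝓘(ℝ, ℝ), ℝ⟯}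
    (hf : f u = 0) (hdf : fderiv ℝ (extendZero f) u = 0) : v f = 0 := by
  have : CompleteSpace Y := FiniteDimensional.complete ℝ Y
  obtain ⟨r, hr, hrU⟩ := Metric.isOpen_iff.1 U.isOpen u u.2
  obtain ⟨G, hG, hGu, hfG⟩ := exists_smooth_fderiv_mean ((contDiffOn_extendZero f).mono hrU)
  let χ : ContDiffBump (u : Y) := ⟨r / 4, r / 2, by linarith, by linarith⟩
  have hχr : χ.rOut < r := by change r / 2 < r; linarith
  have hχu : χ (u : Y) = 1 := χ.one_of_mem_closedBall (mem_closedBall_self χ.rIn_pos.le)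
  let b := Module.finBasis ℝ Y
  let c : Fin (Module.finrank ℝ Y) → C^∞⟮𝓘(ℝ, Y), U; 𝓘(ℝ, ℝ), ℝ⟯ := fun j =>
    restrictSmooth U (fun y => χ y * LinearMap.toContinuousLinearMap (b.coord j) (y - u))
      (contDiff_bump_mul χ hχr (by fun_prop)).contDiffOn
  let d : Fin (Module.finrank ℝ Y) → C^∞⟮𝓘(ℝ, Y), U; 𝓘(ℝ, ℝ), ℝ⟯ := fun j =>
    restrictSmooth U (fun y => χ y * G y (b j))
      (contDiff_bump_mul χ hχr (hG.clm_apply contDiffOn_const)).contDiffOn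
  let e : C^∞⟮𝓘(ℝ, Y), U; 𝓘(ℝ, ℝ), ℝ⟯ := restrictSmooth U (fun y => χ y) χ.contDiff.contDiffOn
  have heu : e u = 1 := hχu
  -- One cutoff goes to each factor, so that both are smooth on all of `U`. As `e u = 1` and `f u =
  -- 0`, multiplying by `e * e` does not change the value of `v`.
  have h1 : e * e * f = ∑ j, c j * d j := by
    ext y
    have h2 : (e * e * f) y = χ y * χ y * f y := rfl
    have h3 : (∑ j, c j * d j) y = ∑ j, (χ y * b.coord j (y - u)) * (χ y * G y (b j)) := by
      rw [← ContMDiffMap.coeFnAlgHom_apply (𝕜 := ℝ) (I := 𝓘(ℝ, Y)) (N := U) (A := ℝ) (n := ∞),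
        map_sum, Finset.sum_apply]
      rfl
    rw [h2, h3]
    by_cases hy : (y : Y) ∈ ball (u : Y) r
    · have h4 := hfG y hy
      rw [extendZero_of_mem f y.2, extendZero_of_mem f u.2, hf, zero_add] at h4
      have h5 : (y : Y) - u = ∑ j, b.coord j (y - u) • b j := (b.sum_repr _).symm
      rw [h4]
      conv_lhs => rw [h5, map_sum]
      rw [Finset.mul_sum]
      refine Finset.sum_congr rfl fun j _ => ?_
      rw [map_smul, smul_eq_mul]
      ring
    · have hz : χ (y : Y) = 0 :=
        χ.zero_of_le_dist (hχr.le.trans (not_lt.1 hy))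
      simp [hz]
  have h2 : v (e * e * f) = v f := by
    rw [hv, hf, zero_smul, add_zero]
    have : (e * e) u = 1 := by
      change e u * e u = 1
      rw [heu, one_mul]
    rw [this, one_smul]
  rw [← h2, h1, map_sum]
  refine Finset.sum_eq_zero fun j _ => ?_
  have hcu : c j u = 0 := by
    change χ (u : Y) * b.coord j (u - u) = 0
    simp
  have hdu : d j u = 0 := by
    change χ (u : Y) * G u (b j) = 0
    rw [hGu, hdf]
    simp
  rw [hv, hcu, hdu, zero_smul, zero_smul, add_zero]

/-- A point derivation on `C^∞(U)` is determined by its values on linear forms. -/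
theorem pointDerivation_eq [FiniteDimensional ℝ Y] {u : U} {v : C^∞⟮𝓘(ℝ, Y), U; 𝓘(ℝ, ℝ), ℝ⟯ →ₗ[ℝ] V}
    (hv : ∀ f g, v (f * g) = f u • v g + g u • v f) (f : C^∞⟮𝓘(ℝ, Y), U; 𝓘(ℝ, ℝ), ℝ⟯) :
    v f = v (restrictSmooth U (fderiv ℝ (extendZero f) u)
      (ContinuousLinearMap.contDiff _).contDiffOn) := by
  set ξ := fderiv ℝ (extendZero f) (u : Y) with hξ
  set l := restrictSmooth U ξ ξ.contDiff.contDiffOn with hl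
  -- The constant makes the remainder of the linear approximation vanish at `u`; constants are
  -- killed by `v`.
  have h : v (f - l - (f u - ξ u) • 1) = 0 := by
    refine pointDerivation_eq_zero hv ?_ ?_
    · change f u - ξ u - (f u - ξ u) • (1 : ℝ) = 0
      simp
    · have hd : HasFDerivAt (extendZero f) ξ u :=
        (((contDiffOn_extendZero f).differentiableOn (by simp)).differentiableAt
          (U.isOpen.mem_nhds u.2)).hasFDerivAt
      have h1 := (hd.sub ξ.hasFDerivAt).sub_const ((f u - ξ u) • (1 : ℝ))
      rw [sub_self] at h1
      refine (h1.congr_of_eventuallyEq ?_).fderiv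
      filter_upwards [U.isOpen.mem_nhds u.2] with y hy
      rw [extendZero_of_mem _ hy]
      simp only [Pi.sub_apply]
      rw [extendZero_of_mem _ hy]
      rfl
  rw [map_sub, map_sub, map_smul, pointDerivation_one hv, smul_zero, sub_zero, sub_eq_zero] at h
  exact h

end PointDerivation

/-! ### Passage between alternating forms and the exterior algebra. -/

section FormMaps

variable {n : ℕ}

instance finiteDimensional_alternating (k : ℕ) : FiniteDimensional ℝ (E n [⋀^Fin k]→L[ℝ] ℝ) :=
  LinearEquiv.finiteDimensional (formEquiv n k)

/-- The inclusion of alternating `k`-forms into `⋀ (ℝⁿ)*`. -/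
def ofForm (n k : ℕ) : (E n [⋀^Fin k]→L[ℝ] ℝ) →L[ℝ] Lam n :=
  LinearMap.toContinuousLinearMap
    ((⋀[ℝ]^k (Module.Dual ℝ (E n))).subtype ∘ₗ (formEquiv n k).symm.toLinearMap)

theorem ofForm_apply {k : ℕ} (β : E n [⋀^Fin k]→L[ℝ] ℝ) :
    ofForm n k β = ((formEquiv n k).symm β : Lam n) := rfl

theorem ofForm_mem {k : ℕ} (β : E n [⋀^Fin k]→L[ℝ] ℝ) :
    ofForm n k β ∈ ⋀[ℝ]^k (Module.Dual ℝ (E n)) := Subtype.mem _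

theorem toForm_ofForm {k : ℕ} (β : E n [⋀^Fin k]→L[ℝ] ℝ) : toForm n k (ofForm n k β) = β := by
  rw [ofForm_apply, toForm_coe, LinearEquiv.apply_symm_apply]

theorem ofForm_toForm {k : ℕ} {a : Lam n} (ha : a ∈ ⋀[ℝ]^k (Module.Dual ℝ (E n))) :
    ofForm n k (toForm n k a) = a := by
  have h := toForm_coe (n := n) ⟨a, ha⟩
  rw [ofForm_apply, h, LinearEquiv.symm_apply_apply]

theorem toForm_algebraMap (r : ℝ) (v : Fin 0 → E n) :
    toForm n 0 (algebraMap ℝ (Lam n) r) v = r := by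
  have h := toForm_ιMulti (n := n) (k := 0) ![] v
  rw [ExteriorAlgebra.ιMulti_zero_apply] at h
  rw [Algebra.algebraMap_eq_smul_one, map_smul, ContinuousAlternatingMap.smul_apply, h]
  simp

theorem algebraMap_mem (r : ℝ) : algebraMap ℝ (Lam n) r ∈ ⋀[ℝ]^0 (Module.Dual ℝ (E n)) :=
  SetLike.algebraMap_mem_graded (fun k : ℕ => ⋀[ℝ]^k (Module.Dual ℝ (E n))) r

theorem dLam_ofForm {k : ℕ} {α : E n → E n [⋀^Fin k]→L[ℝ] ℝ} {x : E n}
    (hα : DifferentiableAt ℝ α x) :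
    dLam (fun y => ofForm n k (α y)) x = ofForm n (k + 1) (extDeriv α x) := by
  have h : HasFDerivAt (fun y => ofForm n k (α y)) ((ofForm n k).comp (fderiv ℝ α x)) x :=
    HasFDerivAt.comp x (g := ofForm n k) (g' := ofForm n k)
      (ContinuousLinearMap.hasFDerivAt _) hα.hasFDerivAt
  have hmem : dLam (fun y => ofForm n k (α y)) x ∈ ⋀[ℝ]^(k + 1) (Module.Dual ℝ (E n)) := by
    rw [dLam, h.fderiv]
    refine Submodule.sum_mem _ fun i _ => ?_
    have h1 : dx i ∈ ⋀[ℝ]^1 (Module.Dual ℝ (E n)) := by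
      rw [exteriorPower_one]; exact ⟨_, rfl⟩
    rw [add_comm k 1]
    exact SetLike.mul_mem_graded (A := fun k : ℕ => ⋀[ℝ]^k (Module.Dual ℝ (E n))) h1
      (ofForm_mem _)
  rw [← ofForm_toForm hmem, toForm_dLam h.differentiableAt]
  simp only [toForm_ofForm]

variable {X F G : Type*} [NormedAddCommGroup X] [NormedSpace ℝ X] [NormedAddCommGroup F]
  [NormedSpace ℝ F] [NormedAddCommGroup G] [NormedSpace ℝ G]

/-- Composition of forms with a continuous linear map. -/
def postcomp (X : Type*) [NormedAddCommGroup X] [NormedSpace ℝ X] (k : ℕ) (g : F →L[ℝ] G) :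
    (X [⋀^Fin k]→L[ℝ] F) →L[ℝ] X [⋀^Fin k]→L[ℝ] G :=
  ContinuousLinearMap.compContinuousAlternatingMapCLM ℝ X F G (Fin k) g

theorem postcomp_apply {k : ℕ} (g : F →L[ℝ] G) (β : X [⋀^Fin k]→L[ℝ] F) :
    postcomp X k g β = g.compContinuousAlternatingMap β := rfl

theorem extDeriv_postcomp {k : ℕ} (g : F →L[ℝ] G) {α : X → X [⋀^Fin k]→L[ℝ] F} {x : X}
    (hα : DifferentiableAt ℝ α x) :
    extDeriv (fun y => postcomp X k g (α y)) x = postcomp X (k + 1) g (extDeriv α x) := by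
  have h : HasFDerivAt (fun y => postcomp X k g (α y)) ((postcomp X k g).comp (fderiv ℝ α x)) x :=
    HasFDerivAt.comp x (g := postcomp X k g) (g' := postcomp X k g)
      (ContinuousLinearMap.hasFDerivAt _) hα.hasFDerivAt
  rw [extDeriv, extDeriv, h.fderiv]
  ext v
  simp [postcomp_apply, ContinuousAlternatingMap.alternatizeUncurryFin_apply]

end FormMaps

/-! ### Substitution of forms into the graded algebra. -/

section Evaluation

variable {W : ℕ → Type*} [∀ k, NormedAddCommGroup (W k)] [∀ k, NormedSpace ℝ (W k)] {n : ℕ}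
  {U : Opens (W 0)}

theorem evalSym_sgen (a : ∀ k, E n [⋀^Fin k]→L[ℝ] W k) (k : ℕ) (ξ : StrongDual ℝ (W (k + 1))) :
    evalSym a (sgen W k ξ) = ofForm n (k + 1) (postcomp (E n) (k + 1) ξ (a (k + 1))) := by
  simp only [evalSym, sgen, LinearMap.comp_apply, AlgHom.toLinearMap_apply]
  rw [RingQuot.liftAlgHom_mkAlgHom_apply, TensorAlgebra.lift_ι_apply, DirectSum.toModule_lof]
  rfl

theorem gradedSym_induction {C : GradedSym W → Prop} (one : ∀ r : ℝ, C (algebraMap ℝ _ r))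
    (gen : ∀ k ξ, C (sgen W k ξ)) (add : ∀ a b, C a → C b → C (a + b))
    (mul : ∀ a b, C a → C b → C (a * b)) (s : GradedSym W) : C s := by
  obtain ⟨s, rfl⟩ := RingQuot.mkAlgHom_surjective ℝ (SymRel W) s
  induction s using TensorAlgebra.induction with
  | algebraMap r => rw [AlgHom.commutes]; exact one r
  | ι m =>
    induction m using DirectSum.induction_on with
    | zero => simpa using one 0
    | of k ξ => exact gen k ξ
    | add a b ha hb => rw [map_add, map_add]; exact add _ _ ha hb
  | mul a b ha hb => rw [map_mul]; exact mul _ _ ha hb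
  | add a b ha hb => rw [map_add]; exact add _ _ ha hb

open Classical in
/-- Substitution of the value at `x` of a form, extended by zero. -/
def evalAt (U : Opens (W 0)) (A : Form0 n W) (x : E n) : Alg U →ₗ[ℝ] Lam n :=
  if hx : A 0 x ![] ∈ U then (evalAlg U (fun k => A k x) hx).toLinearMap else 0

variable {A : Form0 n W} {x : E n}

theorem evalAt_of_mem (hx : A 0 x ![] ∈ U) (F : Alg U) :
    evalAt U A x F = evalAlg U (fun k => A k x) hx F := by
  rw [evalAt, dif_pos hx]
  rfl

theorem evalAt_tmul (hx : A 0 x ![] ∈ U) (f : Smooth U) (s : GradedSym W) :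
    evalAt U A x (f ⊗ₜ s) = extendZero f (A 0 x ![]) • evalSym (fun k => A k x) s := by
  rw [evalAt_of_mem hx, evalAlg, Algebra.TensorProduct.lift_tmul, Algebra.smul_def,
    extendZero_of_mem f hx]
  rfl

theorem evalAt_mul (hx : A 0 x ![] ∈ U) (F G : Alg U) :
    evalAt U A x (F * G) = evalAt U A x F * evalAt U A x G := by
  simp only [evalAt_of_mem hx, map_mul]

theorem evalAt_coordFn (hx : A 0 x ![] ∈ U) (k : ℕ) (ξ : StrongDual ℝ (W k)) :
    evalAt U A x (coordFn U k ξ) = ofForm n k (postcomp (E n) k ξ (A k x)) := by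
  cases k with
  | zero =>
    have h : coordFn U 0 ξ = linSmooth U ξ ⊗ₜ 1 := rfl
    rw [h, evalAt_tmul hx, map_one, ← Algebra.algebraMap_eq_smul_one,
      ← ofForm_toForm (algebraMap_mem _)]
    congr 1
    ext v
    rw [toForm_algebraMap, extendZero_of_mem _ hx, Subsingleton.elim v ![]]
    rfl
  | succ k =>
    have h : coordFn U (k + 1) ξ = (1 : Smooth U) ⊗ₜ sgen W k ξ := rfl
    rw [h, evalAt_tmul hx, evalSym_sgen, extendZero_of_mem _ hx]
    exact one_smul _ _

theorem evalSym_mem (a : ∀ k, E n [⋀^Fin k]→L[ℝ] W k) {m : ℕ} {s : GradedSym W}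
    (hs : s ∈ symDeg W m) : evalSym a s ∈ ⋀[ℝ]^m (Module.Dual ℝ (E n)) := by
  induction hs using Submodule.span_induction with
  | mem s hs =>
    obtain ⟨L, rfl, rfl⟩ := hs
    rw [map_list_prod, List.map_map]
    refine SetLike.list_prod_map_mem_graded (A := fun k : ℕ => ⋀[ℝ]^k (Module.Dual ℝ (E n)))
      L _ _ fun p _ => ?_
    rw [Function.comp_apply, evalSym_sgen]
    exact ofForm_mem _
  | zero => rw [map_zero]; exact Submodule.zero_mem _
  | add a b _ _ ha hb => rw [map_add]; exact Submodule.add_mem _ ha hb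
  | smul c a _ ha => rw [map_smul]; exact Submodule.smul_mem _ _ ha

/-- Preservation of degree makes the sign in the Leibniz rule for `Q` agree with the one for `dLam`.
-/
theorem evalAt_mem (hx : A 0 x ![] ∈ U) {m : ℕ} {F : Alg U} (hF : F ∈ algDeg U m) :
    evalAt U A x F ∈ ⋀[ℝ]^m (Module.Dual ℝ (E n)) := by
  induction hF using Submodule.span_induction with
  | mem a ha =>
    obtain ⟨f, s, hs, rfl⟩ := ha
    rw [evalAt_tmul hx]
    exact Submodule.smul_mem _ _ (evalSym_mem _ hs)
  | zero => rw [map_zero]; exact Submodule.zero_mem _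
  | add a b _ _ ha hb => rw [map_add]; exact Submodule.add_mem _ ha hb
  | smul c a _ ha => rw [map_smul]; exact Submodule.smul_mem _ _ ha

theorem tmul_one_mem_algDeg (f : Smooth U) : f ⊗ₜ[ℝ] (1 : GradedSym W) ∈ algDeg U 0 :=
  Submodule.subset_span ⟨f, 1, Submodule.subset_span ⟨[], rfl, rfl⟩, rfl⟩

theorem coordFn_mem_algDeg (k : ℕ) (ξ : StrongDual ℝ (W k)) : coordFn U k ξ ∈ algDeg U k := by
  cases k with
  | zero => exact tmul_one_mem_algDeg _
  | succ k =>
    exact Submodule.subset_span ⟨1, sgen W k ξ, Submodule.subset_span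
      ⟨[⟨k, ξ⟩], by simp, by simp⟩, rfl⟩

variable {O : Set (E n)}

theorem contDiffOn_evalSym (hA : ∀ k, ContDiffOn ℝ ∞ (A k) O) (s : GradedSym W) :
    ContDiffOn ℝ ∞ (fun x => evalSym (fun k => A k x) s) O := by
  induction s using gradedSym_induction with
  | one r => simpa only [AlgHom.commutes] using contDiffOn_const
  | gen k ξ =>
    simp only [evalSym_sgen]
    have h : ContDiff ℝ ∞ fun a : E n [⋀^Fin (k + 1)]→L[ℝ] W (k + 1) =>
        ofForm n (k + 1) (postcomp (E n) (k + 1) ξ a) := by fun_prop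
    exact h.comp_contDiffOn (hA (k + 1))
  | add a b ha hb => simpa only [map_add] using ha.add hb
  | mul a b ha hb =>
    simp only [map_mul, ← mulCLM_apply]
    have h : ContDiffOn ℝ ∞ (fun x => mulCLM n (evalSym (fun k => A k x) a)) O :=
      ContDiff.comp_contDiffOn (g := mulCLM n) (by fun_prop) ha
    exact h.clm_apply hb

theorem contDiffOn_zeroForm (hA : ContDiffOn ℝ ∞ (A 0) O) :
    ContDiffOn ℝ ∞ (fun x => A 0 x ![]) O := by
  have h : ContDiff ℝ ∞ (ContinuousAlternatingMap.apply ℝ (E n) (W 0) (![] : Fin 0 → E n)) := by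
    fun_prop
  exact h.comp_contDiffOn hA

theorem contDiffOn_evalAt (hA : ∀ k, ContDiffOn ℝ ∞ (A k) O) (hU : ∀ x ∈ O, A 0 x ![] ∈ U)
    (F : Alg U) : ContDiffOn ℝ ∞ (fun x => evalAt U A x F) O := by
  induction F using TensorProduct.induction_on with
  | zero => simpa only [map_zero] using contDiffOn_const
  | tmul f s =>
    have h : ContDiffOn ℝ ∞ (fun x => extendZero f (A 0 x ![])) O :=
      (contDiffOn_extendZero f).comp (contDiffOn_zeroForm (hA 0)) hU
    exact (h.smul (contDiffOn_evalSym hA s)).congr fun x hx => evalAt_tmul (hU x hx) f s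
  | add a b ha hb => simpa only [map_add] using ha.add hb

end Evaluation

/-! ### The defect derivation and the Bianchi identity. -/

section Defect

variable {W : ℕ → Type*} [∀ k, NormedAddCommGroup (W k)] [∀ k, NormedSpace ℝ (W k)]
  {n : ℕ} {U : Opens (W 0)} {A : Form0 n W} {O : Set (E n)} {x : E n}

/-- The failure `d(F(A)) - (QF)(A)` of substitution to commute with the differentials. -/
def defect (Q : Differential U) (A : Form0 n W) (x : E n) (F : Alg U) : Lam n :=
  dLam (fun y => evalAt U A y F) x - evalAt U A x (Q.Q F)

theorem differentiableAt_evalAt (hO : IsOpen O) (hA : ∀ k, ContDiffOn ℝ ∞ (A k) O)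
    (hU : ∀ x ∈ O, A 0 x ![] ∈ U) (hx : x ∈ O) (F : Alg U) :
    DifferentiableAt ℝ (fun y => evalAt U A y F) x :=
  ((contDiffOn_evalAt hA hU F).differentiableOn (by simp)).differentiableAt (hO.mem_nhds hx)

theorem defect_add (Q : Differential U) (hO : IsOpen O) (hA : ∀ k, ContDiffOn ℝ ∞ (A k) O)
    (hU : ∀ x ∈ O, A 0 x ![] ∈ U) (hx : x ∈ O) (F G : Alg U) :
    defect Q A x (F + G) = defect Q A x F + defect Q A x G := by
  simp only [defect, map_add]
  rw [dLam_add (differentiableAt_evalAt hO hA hU hx F) (differentiableAt_evalAt hO hA hU hx G)]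
  abel

theorem defect_smul (Q : Differential U) (hO : IsOpen O) (hA : ∀ k, ContDiffOn ℝ ∞ (A k) O)
    (hU : ∀ x ∈ O, A 0 x ![] ∈ U) (hx : x ∈ O) (c : ℝ) (F : Alg U) :
    defect Q A x (c • F) = c • defect Q A x F := by
  simp only [defect, map_smul]
  rw [dLam_smul c (differentiableAt_evalAt hO hA hU hx F), smul_sub]

theorem dLam_congr {θ η : E n → Lam n} (h : θ =ᶠ[nhds x] η) : dLam θ x = dLam η x := by
  simp only [dLam, h.fderiv_eq]

/-- Difference of two Leibniz rules with equal signs: the defect is a derivation along evaluation,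
hence governed by its values on generators. -/
theorem defect_mul (Q : Differential U) (hO : IsOpen O) (hA : ∀ k, ContDiffOn ℝ ∞ (A k) O)
    (hU : ∀ x ∈ O, A 0 x ![] ∈ U) (hx : x ∈ O) {m : ℕ} {F : Alg U} (hF : F ∈ algDeg U m)
    (G : Alg U) :
    defect Q A x (F * G) =
      defect Q A x F * evalAt U A x G + (-1 : ℝ) ^ m • (evalAt U A x F * defect Q A x G) := by
  have h : (fun y => evalAt U A y (F * G)) =ᶠ[nhds x]
      fun y => evalAt U A y F * evalAt U A y G := by
    filter_upwards [hO.mem_nhds hx] with y hy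
    exact evalAt_mul (hU y hy) F G
  simp only [defect]
  rw [dLam_congr h, dLam_mul (differentiableAt_evalAt hO hA hU hx F)
    (differentiableAt_evalAt hO hA hU hx G) (evalAt_mem (hU x hx) hF), Q.leibniz m F G hF, map_add,
    map_smul, evalAt_mul (hU x hx), evalAt_mul (hU x hx), sub_mul, mul_sub, smul_sub]
  abel

/-- The defect of the Maurer–Cartan equation. -/
def curvature [∀ k, FiniteDimensional ℝ (W k)] (Q : Differential U) (A : Form0 n W) (k : ℕ)
    (x : E n) : E n [⋀^Fin (k + 1)]→L[ℝ] W k :=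
  extDeriv (A k) x - FQ Q A k x

variable [∀ k, FiniteDimensional ℝ (W k)]

theorem defect_coordFn (Q : Differential U) (hO : IsOpen O) (hA : ∀ k, ContDiffOn ℝ ∞ (A k) O)
    (hU : ∀ x ∈ O, A 0 x ![] ∈ U) (hx : x ∈ O) (k : ℕ) (ξ : StrongDual ℝ (W k)) :
    defect Q A x (coordFn U k ξ) =
      ofForm n (k + 1) (postcomp (E n) (k + 1) ξ (curvature Q A k x)) := by
  have h : (fun y => evalAt U A y (coordFn U k ξ)) =ᶠ[nhds x]
      fun y => ofForm n k (postcomp (E n) k ξ (A k y)) := by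
    filter_upwards [hO.mem_nhds hx] with y hy
    exact evalAt_coordFn (hU y hy) k ξ
  have hd : DifferentiableAt ℝ (A k) x :=
    ((hA k).differentiableOn (by simp)).differentiableAt (hO.mem_nhds hx)
  have hd' : DifferentiableAt ℝ (fun y => postcomp (E n) k ξ (A k y)) x :=
    DifferentiableAt.comp x (g := postcomp (E n) k ξ) (by fun_prop) hd
  -- `FQ` records only the component of degree `k + 1`; nothing is lost, since `Q` raises the degree
  -- by one.
  have hQ := ofForm_toForm (evalAt_mem (hU x hx) (Q.degree k _ (coordFn_mem_algDeg k ξ)))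
  rw [evalAt_of_mem (hU x hx), ← pairing_FQ, ← evalAt_of_mem (hU x hx)] at hQ
  rw [defect, dLam_congr h, dLam_ofForm hd', extDeriv_postcomp ξ hd, ← hQ, curvature, map_sub,
    map_sub]
  rfl

/-- The restriction of the defect to `C^∞(U)` is a point derivation. -/
theorem defect_tmul_one (Q : Differential U) (hO : IsOpen O) (hA : ∀ k, ContDiffOn ℝ ∞ (A k) O)
    (hU : ∀ x ∈ O, A 0 x ![] ∈ U) (hx : x ∈ O) (f : Smooth U) :
    defect Q A x (f ⊗ₜ 1) =
      defect Q A x (coordFn U 0 (fderiv ℝ (extendZero f) (A 0 x ![]))) := by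
  let v : Smooth U →ₗ[ℝ] Lam n :=
    { toFun := fun f => defect Q A x (f ⊗ₜ 1)
      map_add' := fun f g => by rw [TensorProduct.add_tmul, defect_add Q hO hA hU hx]
      map_smul' := fun c f => by
        rw [← TensorProduct.smul_tmul', defect_smul Q hO hA hU hx, RingHom.id_apply] }
  have hone : ∀ g : Smooth U, evalAt U A x (g ⊗ₜ 1) =
      algebraMap ℝ (Lam n) (g ⟨A 0 x ![], hU x hx⟩) := by
    intro g
    rw [evalAt_tmul (hU x hx), map_one, extendZero_of_mem g (hU x hx),
      Algebra.algebraMap_eq_smul_one]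
  refine pointDerivation_eq (u := ⟨A 0 x ![], hU x hx⟩) (v := v) (fun f g => ?_) f
  have h : (f * g) ⊗ₜ[ℝ] (1 : GradedSym W) = (f ⊗ₜ 1) * (g ⊗ₜ 1) := by
    rw [Algebra.TensorProduct.tmul_mul_tmul, one_mul]
  change defect Q A x ((f * g) ⊗ₜ 1) = _
  rw [h, defect_mul Q hO hA hU hx (tmul_one_mem_algDeg f), hone, hone, pow_zero, one_smul,
    ← Algebra.smul_def, ← Algebra.commutes, ← Algebra.smul_def, add_comm]
  rfl

/-- On a compact set the defect is bounded by the curvature. -/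
theorem exists_defect_bound (Q : Differential U) (hO : IsOpen O)
    (hA : ∀ k, ContDiffOn ℝ ∞ (A k) O) (hU : ∀ x ∈ O, A 0 x ![] ∈ U) {S : Set (E n)}
    (hS : IsCompact S) (hSO : S ⊆ O) {c : E n → ℝ} (hc : ∀ k, ∀ x ∈ S, ‖curvature Q A k x‖ ≤ c x)
    (F : Alg U) : ∃ K, ∀ x ∈ S, ‖defect Q A x F‖ ≤ K * c x := by
  have hcoord : ∀ k, ∀ x ∈ S, ∀ ξ : StrongDual ℝ (W k),
      ‖defect Q A x (coordFn U k ξ)‖ ≤ ‖ofForm n (k + 1)‖ * ‖ξ‖ * c x := by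
    intro k x hx ξ
    rw [defect_coordFn Q hO hA hU (hSO hx), mul_assoc]
    refine (ContinuousLinearMap.le_opNorm _ _).trans ?_
    gcongr
    refine (ContinuousLinearMap.norm_compContinuousAlternatingMap_le _ _).trans ?_
    gcongr
    exact hc k x hx
  have hadd : ∀ F G : Alg U, (∃ K, ∀ x ∈ S, ‖defect Q A x F‖ ≤ K * c x) →
      (∃ K, ∀ x ∈ S, ‖defect Q A x G‖ ≤ K * c x) →
      ∃ K, ∀ x ∈ S, ‖defect Q A x (F + G)‖ ≤ K * c x := by
    rintro F G ⟨K, hK⟩ ⟨K', hK'⟩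
    refine ⟨K + K', fun x hx => ?_⟩
    rw [defect_add Q hO hA hU (hSO hx), add_mul]
    exact norm_add_le_of_le (hK x hx) (hK' x hx)
  have hmul : ∀ (m : ℕ) (F G : Alg U), F ∈ algDeg U m →
      (∃ K, ∀ x ∈ S, ‖defect Q A x F‖ ≤ K * c x) →
      (∃ K, ∀ x ∈ S, ‖defect Q A x G‖ ≤ K * c x) →
      ∃ K, ∀ x ∈ S, ‖defect Q A x (F * G)‖ ≤ K * c x := by
    rintro m F G hF ⟨K, hK⟩ ⟨K', hK'⟩
    obtain ⟨M, hM⟩ := hS.exists_bound_of_continuousOn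
      ((contDiffOn_evalAt hA hU F).continuousOn.mono hSO)
    obtain ⟨M', hM'⟩ := hS.exists_bound_of_continuousOn
      ((contDiffOn_evalAt hA hU G).continuousOn.mono hSO)
    refine ⟨‖mulCLM n‖ * K * M' + ‖mulCLM n‖ * M * K', fun x hx => ?_⟩
    have h1 := (mulCLM n).le_opNorm₂ (defect Q A x F) (evalAt U A x G)
    have h2 := (mulCLM n).le_opNorm₂ (evalAt U A x F) (defect Q A x G)
    rw [mulCLM_apply] at h1 h2
    have hM0 : 0 ≤ M := (norm_nonneg _).trans (hM x hx)
    -- `K` itself has no known sign; only the product is nonnegative.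
    have hK0 : 0 ≤ K * c x := (norm_nonneg _).trans (hK x hx)
    rw [defect_mul Q hO hA hU (hSO hx) hF]
    calc _ ≤ ‖defect Q A x F * evalAt U A x G‖ + ‖evalAt U A x F * defect Q A x G‖ := by
          refine (norm_add_le _ _).trans (add_le_add le_rfl ?_)
          rw [norm_smul]
          simp
      _ ≤ ‖mulCLM n‖ * (K * c x) * M' + ‖mulCLM n‖ * M * (K' * c x) := by
          refine add_le_add (h1.trans ?_) (h2.trans ?_)
          · gcongr
            · exact hK x hx
            · exact hM' x hx
          · gcongr
            · exact hM x hx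
            · exact hK' x hx
      _ = _ := by ring
  have hsmooth : ∀ f : Smooth U, ∃ K, ∀ x ∈ S, ‖defect Q A x (f ⊗ₜ 1)‖ ≤ K * c x := by
    intro f
    have hcont : ContinuousOn (fun x => fderiv ℝ (extendZero f) (A 0 x ![])) O :=
      ((contDiffOn_infty_iff_fderiv_of_isOpen U.isOpen).1
        (contDiffOn_extendZero f)).2.continuousOn.comp
          (contDiffOn_zeroForm (hA 0)).continuousOn hU
    obtain ⟨M, hM⟩ := hS.exists_bound_of_continuousOn (hcont.mono hSO)
    refine ⟨‖ofForm n 1‖ * M, fun x hx => ?_⟩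
    rw [defect_tmul_one Q hO hA hU (hSO hx)]
    refine (hcoord 0 x hx _).trans ?_
    have hc0 : 0 ≤ c x := (norm_nonneg _).trans (hc 0 x hx)
    gcongr
    exact hM x hx
  -- Multiplying onto an arbitrary `G` lets a product be built one generator at a time from the
  -- left, so `hmul` is only applied with a homogeneous left factor.
  have hsym : ∀ (s : GradedSym W) (G : Alg U), (∃ K, ∀ x ∈ S, ‖defect Q A x G‖ ≤ K * c x) →
      ∃ K, ∀ x ∈ S, ‖defect Q A x (((1 : Smooth U) ⊗ₜ[ℝ] s) * G)‖ ≤ K * c x := by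
    intro s
    induction s using gradedSym_induction with
    | one r =>
      rintro G ⟨K, hK⟩
      refine ⟨|r| * K, fun x hx => ?_⟩
      have h : ((1 : Smooth U) ⊗ₜ[ℝ] algebraMap ℝ (GradedSym W) r) * G = r • G := by
        rw [Algebra.algebraMap_eq_smul_one, TensorProduct.tmul_smul, smul_mul_assoc,
          ← Algebra.TensorProduct.one_def, one_mul]
      rw [h, defect_smul Q hO hA hU (hSO hx), norm_smul, mul_assoc, Real.norm_eq_abs]
      gcongr
      exact hK x hx
    | gen k ξ =>
      exact fun G hG => hmul (k + 1) _ G (coordFn_mem_algDeg (k + 1) ξ)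
        ⟨_, fun x hx => hcoord (k + 1) x hx ξ⟩ hG
    | add a b ha hb =>
      intro G hG
      rw [TensorProduct.tmul_add, add_mul]
      exact hadd _ _ (ha G hG) (hb G hG)
    | mul a b ha hb =>
      intro G hG
      have h : (1 : Smooth U) ⊗ₜ[ℝ] (a * b) = (1 ⊗ₜ a) * (1 ⊗ₜ b) := by
        rw [Algebra.TensorProduct.tmul_mul_tmul, one_mul]
      rw [h, mul_assoc]
      exact ha _ (hb G hG)
  induction F using TensorProduct.induction_on with
  | zero =>
    refine ⟨0, fun x hx => ?_⟩
    have h := defect_smul Q hO hA hU (hSO hx) 0 0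
    rw [zero_smul, zero_smul] at h
    rw [h, norm_zero, zero_mul]
  | tmul f s =>
    have h : f ⊗ₜ[ℝ] s = ((1 : Smooth U) ⊗ₜ[ℝ] s) * (f ⊗ₜ 1) := by
      rw [Algebra.TensorProduct.tmul_mul_tmul, one_mul, mul_one]
    rw [h]
    exact hsym s _ (hsmooth f)
  | add a b ha hb => exact hadd a b ha hb

/-- The linear coordinates on `W k` given by a basis. -/
def basisCoord (W : ℕ → Type*) [∀ k, NormedAddCommGroup (W k)] [∀ k, NormedSpace ℝ (W k)]
    [∀ k, FiniteDimensional ℝ (W k)] (k : ℕ) (i : Fin (Module.finrank ℝ (W k))) :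
    StrongDual ℝ (W k) :=
  LinearMap.toContinuousLinearMap ((Module.finBasis ℝ (W k)).coord i)

/-- The inclusion of scalar forms as the forms with values in the line of a basis vector. -/
def basisIncl (n : ℕ) (W : ℕ → Type*) [∀ k, NormedAddCommGroup (W k)] [∀ k, NormedSpace ℝ (W k)]
    [∀ k, FiniteDimensional ℝ (W k)] (k m : ℕ) (i : Fin (Module.finrank ℝ (W k))) :
    (E n [⋀^Fin m]→L[ℝ] ℝ) →L[ℝ] E n [⋀^Fin m]→L[ℝ] W k :=
  postcomp (E n) m (ContinuousLinearMap.toSpanSingleton ℝ (Module.finBasis ℝ (W k) i))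

theorem FQ_eq (Q : Differential U) (hx : A 0 x ![] ∈ U) (k : ℕ) :
    FQ Q A k x = ∑ i, basisIncl n W k (k + 1) i
      (toFormCLM n (k + 1) (evalAt U A x (Q.Q (coordFn U k (basisCoord W k i))))) := by
  simp only [FQ, dif_pos hx, evalAt_of_mem hx]
  rfl

theorem contDiffOn_basisIncl (Q : Differential U) (hA : ∀ k, ContDiffOn ℝ ∞ (A k) O)
    (hU : ∀ x ∈ O, A 0 x ![] ∈ U) (k : ℕ) (i : Fin (Module.finrank ℝ (W k))) :
    ContDiffOn ℝ ∞ (fun x => basisIncl n W k (k + 1) i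
      (toFormCLM n (k + 1) (evalAt U A x (Q.Q (coordFn U k (basisCoord W k i)))))) O := by
  have h : ContDiff ℝ ∞ fun a => basisIncl n W k (k + 1) i (toFormCLM n (k + 1) a) := by fun_prop
  exact h.comp_contDiffOn (contDiffOn_evalAt hA hU _)

theorem contDiffOn_FQ (Q : Differential U) (hA : ∀ k, ContDiffOn ℝ ∞ (A k) O)
    (hU : ∀ x ∈ O, A 0 x ![] ∈ U) (k : ℕ) : ContDiffOn ℝ ∞ (FQ Q A k) O :=
  (ContDiffOn.sum fun i _ => contDiffOn_basisIncl Q hA hU k i).congr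
    fun x hx => FQ_eq Q (hU x hx) k

/-- The Bianchi identity: since `Q² = 0`, the term `(Q(Qξ))(A)` of the defect of `Qξ` vanishes and
only `d((Qξ)(A))` is left. -/
theorem extDeriv_FQ (Q : Differential U) (hO : IsOpen O) (hA : ∀ k, ContDiffOn ℝ ∞ (A k) O)
    (hU : ∀ x ∈ O, A 0 x ![] ∈ U) (hx : x ∈ O) (k : ℕ) :
    extDeriv (FQ Q A k) x = ∑ i, basisIncl n W k (k + 2) i
      (toFormCLM n (k + 2) (defect Q A x (Q.Q (coordFn U k (basisCoord W k i))))) := by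
  have h : FQ Q A k =ᶠ[nhds x] fun x => ∑ i, basisIncl n W k (k + 1) i
      (toFormCLM n (k + 1) (evalAt U A x (Q.Q (coordFn U k (basisCoord W k i))))) := by
    filter_upwards [hO.mem_nhds hx] with y hy
    exact FQ_eq Q (hU y hy) k
  have hd := fun i => ((contDiffOn_basisIncl Q hA hU k i).differentiableOn
    (by simp)).differentiableAt (hO.mem_nhds hx)
  rw [h.extDeriv_eq, extDeriv, fderiv_fun_sum fun i _ => hd i,
    ← ContinuousAlternatingMap.alternatizeUncurryFinCLM_apply, map_sum]
  refine Finset.sum_congr rfl fun i _ => ?_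
  have he := differentiableAt_evalAt hO hA hU hx (Q.Q (coordFn U k (basisCoord W k i)))
  have he' : DifferentiableAt ℝ (fun y => toFormCLM n (k + 1) (evalAt U A y
      (Q.Q (coordFn U k (basisCoord W k i))))) x :=
    DifferentiableAt.comp x (g := toFormCLM n (k + 1)) (by fun_prop) he
  rw [defect, Q.sq_zero, map_zero, sub_zero]
  refine (extDeriv_postcomp _ he').trans ?_
  rw [basisIncl]
  congr 1
  exact (toForm_dLam he).symm

theorem exists_extDeriv_FQ_bound (Q : Differential U) (hO : IsOpen O)
    (hA : ∀ k, ContDiffOn ℝ ∞ (A k) O) (hU : ∀ x ∈ O, A 0 x ![] ∈ U) {S : Set (E n)}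
    (hS : IsCompact S) (hSO : S ⊆ O) {c : E n → ℝ} (hc : ∀ k, ∀ x ∈ S, ‖curvature Q A k x‖ ≤ c x)
    (k : ℕ) : ∃ K, ∀ x ∈ S, ‖extDeriv (FQ Q A k) x‖ ≤ K * c x := by
  choose K hK using exists_defect_bound Q hO hA hU hS hSO hc
  refine ⟨∑ i, ‖(basisIncl n W k (k + 2) i).comp (toFormCLM n (k + 2))‖ *
    K (Q.Q (coordFn U k (basisCoord W k i))), fun x hx => ?_⟩
  rw [extDeriv_FQ Q hO hA hU (hSO hx), Finset.sum_mul]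
  refine norm_sum_le_of_le _ fun i _ => ?_
  refine (((basisIncl n W k (k + 2) i).comp (toFormCLM n (k + 2))).le_opNorm _).trans ?_
  rw [mul_assoc]
  gcongr
  exact hK _ x hx

end Defect

/-! ### Gronwall's lemma. -/

section Gronwall

open Set

/-- Gronwall's lemma in integral form with zero initial value. -/
theorem eq_zero_of_le_integral {γ : ℝ → ℝ} (hγ : ContinuousOn γ (Icc 0 1))
    (h0 : ∀ s ∈ Icc (0 : ℝ) 1, 0 ≤ γ s) {M : ℝ}
    (hM : ∀ s ∈ Icc (0 : ℝ) 1, γ s ≤ M * ∫ t in (0 : ℝ)..s, γ t) :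
    ∀ s ∈ Icc (0 : ℝ) 1, γ s = 0 := by
  -- A continuous extension to `ℝ` has an everywhere differentiable primitive, endpoints included.
  -- The differential form of Gronwall is applied to this primitive.
  set δ : ℝ → ℝ := IccExtend zero_le_one ((Icc (0 : ℝ) 1).domRestrict γ) with hδ
  have hδc : Continuous δ := (continuousOn_iff_continuous_domRestrict.1 hγ).Icc_extend'
  have hδγ : ∀ s ∈ Icc (0 : ℝ) 1, δ s = γ s := fun s hs => IccExtend_of_mem _ _ hs
  have hI : ∀ s ∈ Icc (0 : ℝ) 1, ∫ t in (0 : ℝ)..s, γ t = ∫ t in (0 : ℝ)..s, δ t := by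
    intro s hs
    refine intervalIntegral.integral_congr fun t ht => ?_
    rw [uIcc_of_le hs.1] at ht
    exact (hδγ t ⟨ht.1, ht.2.trans hs.2⟩).symm
  have hI0 : ∀ s ∈ Icc (0 : ℝ) 1, 0 ≤ ∫ t in (0 : ℝ)..s, δ t := by
    intro s hs
    refine intervalIntegral.integral_nonneg hs.1 fun t ht => ?_
    have ht' : t ∈ Icc (0 : ℝ) 1 := ⟨ht.1, ht.2.trans hs.2⟩
    rw [hδγ t ht']
    exact h0 t ht'
  have hderiv : ∀ s, HasDerivAt (fun s => ∫ t in (0 : ℝ)..s, δ t) (δ s) s := fun s =>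
    intervalIntegral.integral_hasDerivAt_right (hδc.intervalIntegrable _ _)
      (hδc.stronglyMeasurableAtFilter _ _) hδc.continuousAt
  have key := norm_le_gronwallBound_of_norm_deriv_right_le (δ := 0) (K := M) (ε := 0)
    (f := fun s => ∫ t in (0 : ℝ)..s, δ t) (f' := δ) (a := 0) (b := 1)
    (fun s _ => (hderiv s).continuousAt.continuousWithinAt)
    (fun s _ => (hderiv s).hasDerivWithinAt) (by simp) (by
      intro s hs
      have hs' := Ico_subset_Icc_self hs
      rw [Real.norm_of_nonneg (hI0 s hs'), hδγ s hs', Real.norm_of_nonneg (h0 s hs'), add_zero,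
        ← hI s hs']
      exact hM s hs')
  intro s hs
  have h1 := key s hs
  rw [gronwallBound_ε0_δ0, norm_le_zero_iff] at h1
  have h2 := hM s hs
  rw [hI s hs, h1, mul_zero] at h2
  exact le_antisymm h2 (h0 s hs)

end Gronwall

/-! ### Unique derivatives on submanifolds with corners. -/

section Corners

variable {n : ℕ} {N : Set (E n)}

theorem uniqueDiffOn_quadrant (S : Set (Fin n)) :
    UniqueDiffOn ℝ {y : E n | ∀ i ∈ S, 0 ≤ y i} := by
  refine uniqueDiffOn_convex ?_ ?_
  · intro y hy z hz a b ha hb _ i hi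
    have h1 := hy i hi
    have h2 := hz i hi
    simp only [PiLp.add_apply, PiLp.smul_apply, smul_eq_mul]
    positivity
  · have hopen : IsOpen {y : E n | ∀ i, 0 < y i} := by
      simp only [Set.ofPred_forall]
      exact isOpen_iInter_of_finite fun i => isOpen_lt continuous_const (by fun_prop)
    refine ⟨WithLp.toLp 2 fun _ => 1, mem_interior.2 ⟨{y : E n | ∀ i, 0 < y i},
      fun y hy i _ => (hy i).le, hopen, fun i => ?_⟩⟩
    simp

/-- A quadrant is convex with nonempty interior, and the inverse chart carries unique
differentiability over because its derivative is surjective. -/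
theorem IsSubmanifoldWithCorners.uniqueDiffOn (hN : IsSubmanifoldWithCorners N) :
    UniqueDiffOn ℝ N := by
  intro x hx
  obtain ⟨φ, S, hxs, hφ, hφ', hS⟩ := hN x hx
  have hxt : φ x ∈ φ.target := φ.map_source hxs
  have h1 : HasFDerivAt φ (fderiv ℝ φ x) x :=
    ((hφ.differentiableOn (by simp)).differentiableAt (φ.open_source.mem_nhds hxs)).hasFDerivAt
  have h2 : HasFDerivAt φ.symm (fderiv ℝ φ.symm (φ x)) (φ x) :=
    ((hφ'.differentiableOn (by simp)).differentiableAt (φ.open_target.mem_nhds hxt)).hasFDerivAt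
  have h3 : (fderiv ℝ φ.symm (φ x)).comp (fderiv ℝ φ x) = ContinuousLinearMap.id ℝ (E n) := by
    refine (h2.comp x h1).unique ((hasFDerivAt_id x).congr_of_eventuallyEq ?_)
    filter_upwards [φ.open_source.mem_nhds hxs] with y hy
    exact φ.left_inv hy
  have hsurj : Function.Surjective (fderiv ℝ φ.symm (φ x)) := fun v =>
    ⟨fderiv ℝ φ x v, congrArg (fun L : E n →L[ℝ] E n => L v) h3⟩
  have hquad : UniqueDiffWithinAt ℝ ({y : E n | ∀ i ∈ S, 0 ≤ y i} ∩ φ.target) (φ x) :=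
    (uniqueDiffOn_quadrant S _ ((hS x hxs).1 hx)).inter (φ.open_target.mem_nhds hxt)
  have himage := h2.hasFDerivWithinAt.uniqueDiffWithinAt hquad hsurj.denseRange
  rw [φ.left_inv hxs] at himage
  refine himage.mono ?_
  rintro _ ⟨y, ⟨hy, hyt⟩, rfl⟩
  rw [hS _ (φ.map_target hyt), φ.right_inv hyt]
  exact hy

theorem extDerivWithin_eq_extDeriv {k : ℕ} {F : Type*} [NormedAddCommGroup F] [NormedSpace ℝ F]
    (hN : UniqueDiffOn ℝ N) {O : Set (E n)} (hO : IsOpen O) (hNO : N ⊆ O)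
    {α β : E n → E n [⋀^Fin k]→L[ℝ] F} (hβ : ContDiffOn ℝ ∞ β O) (h : Set.EqOn α β N) {x : E n}
    (hx : x ∈ N) : extDerivWithin α N x = extDeriv β x := by
  rw [extDerivWithin_congr' h hx, extDerivWithin, extDeriv, DifferentiableAt.fderivWithin
    ((hβ.differentiableOn (by simp)).differentiableAt (hO.mem_nhds (hNO hx))) (hN x hx)]

end Corners

/-! ### Extension off `N`, and the vanishing of the curvature. -/

section Extension

variable {W : ℕ → Type*} [∀ k, NormedAddCommGroup (W k)] [∀ k, NormedSpace ℝ (W k)]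
  {n : ℕ} {U : Opens (W 0)} {N : Set (E n)} {A B : Form0 n W}

/-- The points whose whole segment to the origin lies in `O` form an open set because `[0,1]` is
compact. -/
theorem exists_isOpen_starShaped {O : Set (E n)} (hO : IsOpen O) (hstar : StarConvex ℝ 0 N)
    (hNO : N ⊆ O) : ∃ O' ⊆ O, IsOpen O' ∧ N ⊆ O' ∧
      ∀ x ∈ O', ∀ t ∈ Set.Icc (0 : ℝ) 1, t • x ∈ O' := by
  refine ⟨{x | ∀ t ∈ Set.Icc (0 : ℝ) 1, t • x ∈ O}, fun x hx => ?_, ?_, fun x hx t ht => ?_, ?_⟩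
  · simpa using hx 1 (by simp)
  · rw [isOpen_iff_mem_nhds]
    intro x hx
    refine isCompact_Icc.eventually_forall_of_forall_eventually fun t ht => ?_
    have hc : Continuous fun p : E n × ℝ => p.2 • p.1 := by fun_prop
    exact hc.continuousAt.eventually (hO.mem_nhds (hx t ht))
  · exact hNO (starConvex_zero_iff.1 hstar hx ht.1 ht.2)
  · intro x hx t ht s hs
    rw [smul_smul]
    exact hx _ ⟨mul_nonneg hs.1 ht.1, mul_le_one₀ hs.2 ht.1 ht.2⟩

theorem exists_extension (hstar : StarConvex ℝ 0 N) (hW : {k | Nontrivial (W k)}.Finite)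
    (hA : IsForm0In N U A) : ∃ (O : Set (E n)) (B : Form0 n W), IsOpen O ∧ N ⊆ O ∧
      (∀ x ∈ O, ∀ t ∈ Set.Icc (0 : ℝ) 1, t • x ∈ O) ∧ (∀ k, ContDiffOn ℝ ∞ (B k) O) ∧
      (∀ x ∈ O, B 0 x ![] ∈ U) ∧ ∀ k, Set.EqOn (A k) (B k) N := by
  obtain ⟨hA, hAU⟩ := hA
  choose O B hO hNO hB hAB using hA
  -- Finitely many nonzero `W k` keep the common domain open; in the other degrees every form is
  -- zero.
  have hO₁ : IsOpen (⋂ k ∈ insert 0 hW.toFinset, O k) :=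
    isOpen_biInter_finset fun k _ => hO k
  have hB₁ : ∀ k, ContDiffOn ℝ ∞ (B k) (⋂ k ∈ insert 0 hW.toFinset, O k) := by
    intro k
    by_cases hk : k ∈ insert 0 hW.toFinset
    · exact (hB k).mono (Set.biInter_subset_of_mem hk)
    · have : Subsingleton (W k) := by
        rw [← not_nontrivial_iff_subsingleton]
        intro h
        exact hk (Finset.mem_insert_of_mem (hW.mem_toFinset.2 h))
      have : Subsingleton (E n [⋀^Fin k]→L[ℝ] W k) :=
        ⟨fun a b => by ext v; exact Subsingleton.elim _ _⟩
      exact contDiff_of_subsingleton.contDiffOn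
  have hO₂ := (contDiffOn_zeroForm (hB₁ 0)).continuousOn.isOpen_inter_preimage hO₁ U.isOpen
  obtain ⟨O', hO'sub, hO', hNO', hO'star⟩ := exists_isOpen_starShaped hO₂ hstar (by
    refine Set.subset_inter (Set.subset_iInter₂ fun k _ => hNO k) fun x hx => ?_
    rw [Set.mem_preimage, ← hAB 0 hx]
    exact hAU x hx)
  exact ⟨O', B, hO', hNO', hO'star,
    fun k => (hB₁ k).mono fun x hx => (hO'sub hx).1, fun x hx => (hO'sub hx).2, hAB⟩

theorem hOp_congr {k : ℕ} {F : Type*} [NormedAddCommGroup F] [NormedSpace ℝ F]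
    (hstar : StarConvex ℝ 0 N) {α β : E n → E n [⋀^Fin (k + 1)]→L[ℝ] F} (h : Set.EqOn α β N)
    {x : E n} (hx : x ∈ N) : hOp α x = hOp β x := by
  refine intervalIntegral.integral_congr fun t ht => ?_
  rw [Set.uIcc_of_le zero_le_one] at ht
  simp only [h (starConvex_zero_iff.1 hstar hx ht.1 ht.2)]

theorem contDiffOn_hOp {k : ℕ} {F : Type*} [NormedAddCommGroup F] [NormedSpace ℝ F]
    {O : Set (E n)} (hO : IsOpen O) (hOs : ∀ x ∈ O, ∀ t ∈ Set.Icc (0 : ℝ) 1, t • x ∈ O)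
    {α : E n → E n [⋀^Fin (k + 1)]→L[ℝ] F} (hα : ContDiffOn ℝ ∞ α O) :
    ContDiffOn ℝ ∞ (hOp α) O :=
  contDiffOn_integral (hO.preimage (by fun_prop : Continuous fun p : E n × ℝ => p.2 • p.1)) hO hOs
    (contDiffOn_hIntegrand hα)

variable [∀ k, FiniteDimensional ℝ (W k)]

theorem FQ_congr (Q : Differential U) {x : E n} (h : ∀ k, A k x = B k x) (k : ℕ) :
    FQ Q A k x = FQ Q B k x := by
  -- `FQ` at `x` sees only the values at `x`, so the forms may be replaced by constant ones.
  have h1 : FQ Q A k x = FQ Q (fun j _ => A j x) k x := rfl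
  rw [h1, funext fun j => congrArg (fun a (_ : E n) => a) (h j)]
  rfl

theorem eqOn_kuranishi (Q : Differential U) (hstar : StarConvex ℝ 0 N)
    (h : ∀ k, Set.EqOn (A k) (B k) N) (k : ℕ) :
    Set.EqOn (kuranishi Q A k) (kuranishi Q B k) N := by
  intro x hx
  have h1 : hOp (FQ Q A k) x = hOp (FQ Q B k) x :=
    hOp_congr hstar (fun y hy => FQ_congr Q (fun j => h j hy) k) hx
  simp only [kuranishi, h k hx, h1]

theorem extDeriv_kuranishi (Q : Differential U) {O : Set (E n)} (hO : IsOpen O)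
    (hOs : ∀ x ∈ O, ∀ t ∈ Set.Icc (0 : ℝ) 1, t • x ∈ O) (hB : ∀ k, ContDiffOn ℝ ∞ (B k) O)
    (hU : ∀ x ∈ O, B 0 x ![] ∈ U) (k : ℕ) {x : E n} (hx : x ∈ O) :
    extDeriv (kuranishi Q B k) x = curvature Q B k x + hOp (extDeriv (FQ Q B k)) x := by
  have : CompleteSpace (W k) := FiniteDimensional.complete ℝ (W k)
  have hF := contDiffOn_FQ Q hB hU k
  have h1 : DifferentiableAt ℝ (B k) x :=
    ((hB k).differentiableOn (by simp)).differentiableAt (hO.mem_nhds hx)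
  have h2 : DifferentiableAt ℝ (hOp (FQ Q B k)) x :=
    ((contDiffOn_hOp hO hOs hF).differentiableOn (by simp)).differentiableAt (hO.mem_nhds hx)
  have h3 : extDeriv (hOp (FQ Q B k)) x + hOp (extDeriv (FQ Q B k)) x = FQ Q B k x :=
    extDeriv_integral_add hO hF (hOs x hx)
  have h4 : extDeriv (kuranishi Q B k) x = extDeriv (B k) x - extDeriv (hOp (FQ Q B k)) x := by
    have h5 : fderiv ℝ (kuranishi Q B k) x = fderiv ℝ (B k) x - fderiv ℝ (hOp (FQ Q B k)) x :=
      fderiv_sub h1 h2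
    rw [extDeriv, h5, ← ContinuousAlternatingMap.alternatizeUncurryFinCLM_apply, map_sub]
    rfl
  rw [h4, curvature, ← h3]
  abel

/-- Contraction with `s • x` supplies the factor `s`, exactly the Jacobian of the substitution `t ↦
t * s`; the factor `t ^ k ≤ 1` is dropped. This turns an integral over `[0,1]` into one over
`[0,s]`, as Gronwall needs. -/
theorem norm_hOp_le {k : ℕ} {F : Type*} [NormedAddCommGroup F] [NormedSpace ℝ F]
    {α : E n → E n [⋀^Fin (k + 1)]→L[ℝ] F} {x : E n} {s K : ℝ} (hs : s ∈ Set.Icc (0 : ℝ) 1)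
    {γ : ℝ → ℝ} (hγ : ContinuousOn γ (Set.Icc 0 1))
    (h : ∀ t ∈ Set.Icc (0 : ℝ) 1, ‖α (t • x)‖ ≤ K * γ t) :
    ‖hOp α (s • x)‖ ≤ K * ‖x‖ * ∫ t in (0 : ℝ)..s, γ t := by
  have hts : ∀ t ∈ Set.Icc (0 : ℝ) 1, t * s ∈ Set.Icc (0 : ℝ) 1 := fun t ht =>
    ⟨mul_nonneg ht.1 hs.1, mul_le_one₀ ht.2 hs.1 hs.2⟩
  have h1 : ‖hOp α (s • x)‖ ≤ ∫ t in (0 : ℝ)..1, K * γ (t * s) * (s * ‖x‖) := by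
    refine intervalIntegral.norm_integral_le_of_norm_le zero_le_one
      (Filter.Eventually.of_forall fun t ht => ?_) ?_
    · have ht' : t ∈ Set.Icc (0 : ℝ) 1 := Set.Ioc_subset_Icc_self ht
      have h2 : ‖(α (t • s • x)).curryLeft (s • x)‖ ≤ K * γ (t * s) * (s * ‖x‖) := by
        refine (ContinuousLinearMap.le_opNorm _ _).trans ?_
        rw [ContinuousAlternatingMap.norm_curryLeft, norm_smul, Real.norm_of_nonneg hs.1,
          smul_smul]
        have := h _ (hts t ht')
        have := hs.1
        gcongr
      rw [norm_smul, norm_pow, Real.norm_of_nonneg ht'.1]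
      exact (mul_le_of_le_one_left (norm_nonneg _) (pow_le_one₀ ht'.1 ht'.2)).trans h2
    · refine ContinuousOn.intervalIntegrable_of_Icc zero_le_one ?_
      have : ContinuousOn (fun t => γ (t * s)) (Set.Icc 0 1) := hγ.comp (by fun_prop) hts
      exact (continuousOn_const.mul this).mul continuousOn_const
  refine h1.trans (le_of_eq ?_)
  have h2 := intervalIntegral.mul_integral_comp_mul_right (a := 0) (b := 1) (f := γ) s
  rw [zero_mul, one_mul] at h2
  rw [← h2, ← intervalIntegral.integral_const_mul, ← intervalIntegral.integral_const_mul]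
  refine intervalIntegral.integral_congr fun t _ => ?_
  ring

theorem hOp_eq_zero {k : ℕ} {F : Type*} [NormedAddCommGroup F] [NormedSpace ℝ F]
    (hstar : StarConvex ℝ 0 N) {α : E n → E n [⋀^Fin (k + 1)]→L[ℝ] F} (h : ∀ x ∈ N, α x = 0)
    {x : E n} (hx : x ∈ N) : hOp α x = 0 := by
  rw [hOp_congr hstar (β := fun _ => 0) h hx]
  simp [hOp]

/-- `∑ₖ ‖Cₖ‖` for the curvature `C`. -/
def totalNorm (Q : Differential U) (B : Form0 n W) (hW : {k | Nontrivial (W k)}.Finite)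
    (x : E n) : ℝ :=
  ∑ k ∈ hW.toFinset, ‖curvature Q B k x‖

theorem norm_curvature_le (Q : Differential U) (hW : {k | Nontrivial (W k)}.Finite) (k : ℕ)
    (x : E n) : ‖curvature Q B k x‖ ≤ totalNorm Q B hW x := by
  by_cases hk : k ∈ hW.toFinset
  · exact Finset.single_le_sum (f := fun k => ‖curvature Q B k x‖) (fun _ _ => norm_nonneg _) hk
  · have : Subsingleton (W k) := by
      rw [← not_nontrivial_iff_subsingleton]
      exact fun h => hk (hW.mem_toFinset.2 h)
    have h0 : curvature Q B k x = 0 := by ext v; exact Subsingleton.elim _ _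
    rw [h0, norm_zero]
    exact Finset.sum_nonneg fun _ _ => norm_nonneg _

theorem continuousOn_totalNorm (Q : Differential U) (hW : {k | Nontrivial (W k)}.Finite)
    {O : Set (E n)} (hO : IsOpen O) (hB : ∀ k, ContDiffOn ℝ ∞ (B k) O)
    (hU : ∀ x ∈ O, B 0 x ![] ∈ U) : ContinuousOn (totalNorm Q B hW) O :=
  continuousOn_finsetSum _ fun k _ =>
    ((contDiffOn_extDeriv hO (hB k)).sub (contDiffOn_FQ Q hB hU k)).continuousOn.norm

/-- If the curvature vanishes on `N`, then so does the exterior derivative of `F_Q`. -/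
theorem extDeriv_FQ_eq_zero (Q : Differential U) {O : Set (E n)} (hO : IsOpen O)
    (hB : ∀ k, ContDiffOn ℝ ∞ (B k) O) (hU : ∀ x ∈ O, B 0 x ![] ∈ U) {x : E n} (hx : x ∈ O)
    (h : ∀ k, curvature Q B k x = 0) (k : ℕ) : extDeriv (FQ Q B k) x = 0 := by
  -- The bound on the compact set `{x}`, with curvature bound `0`.
  obtain ⟨K, hK⟩ := exists_extDeriv_FQ_bound Q hO hB hU (S := {x}) isCompact_singleton
    (by simpa using hx) (c := fun _ => 0) (by simp [h]) k
  simpa using hK x rfl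

/-- If the curvature satisfies `C + h d F_Q = 0` on `N`, then it vanishes. -/
theorem curvature_eq_zero (Q : Differential U) (hW : {k | Nontrivial (W k)}.Finite)
    (hstar : StarConvex ℝ 0 N) {O : Set (E n)} (hO : IsOpen O) (hNO : N ⊆ O)
    (hB : ∀ k, ContDiffOn ℝ ∞ (B k) O) (hU : ∀ x ∈ O, B 0 x ![] ∈ U)
    (h : ∀ k, ∀ x ∈ N, curvature Q B k x + hOp (extDeriv (FQ Q B k)) x = 0) {x : E n}
    (hx : x ∈ N) (k : ℕ) : curvature Q B k x = 0 := by
  have hseg : ∀ t ∈ Set.Icc (0 : ℝ) 1, t • x ∈ N := fun t ht =>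
    starConvex_zero_iff.1 hstar hx ht.1 ht.2
  have hS : IsCompact ((fun t : ℝ => t • x) '' Set.Icc 0 1) :=
    isCompact_Icc.image (by fun_prop)
  have hSO : (fun t : ℝ => t • x) '' Set.Icc 0 1 ⊆ O := by
    rintro _ ⟨t, ht, rfl⟩
    exact hNO (hseg t ht)
  choose K hK using exists_extDeriv_FQ_bound Q hO hB hU hS hSO
    (fun k x _ => norm_curvature_le Q hW k x)
  have hγ : ContinuousOn (fun t : ℝ => totalNorm Q B hW (t • x)) (Set.Icc 0 1) :=
    (continuousOn_totalNorm Q hW hO hB hU).comp (by fun_prop) fun t ht => hNO (hseg t ht)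
  -- All degrees are summed before Gronwall is applied, since the bound for one degree involves the
  -- curvature in every degree.
  have hzero := eq_zero_of_le_integral hγ
    (fun s _ => Finset.sum_nonneg fun _ _ => norm_nonneg _)
    (M := ∑ k ∈ hW.toFinset, K k * ‖x‖) (fun s hs => by
      rw [totalNorm, Finset.sum_mul]
      refine Finset.sum_le_sum fun k _ => ?_
      rw [eq_neg_of_add_eq_zero_left (h k _ (hseg s hs)), norm_neg]
      exact norm_hOp_le hs hγ fun t ht => hK k _ ⟨t, ht, rfl⟩) 1 (by simp)
  have hle := norm_curvature_le Q hW k (B := B) x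
  rw [one_smul] at hzero
  rw [hzero] at hle
  exact norm_le_zero_iff.1 hle

end Extension

end GradedMC

end

/-! ### The theorem: transfer between `A` on `N` and its extension. -/

theorem mainTheorem2 {n : ℕ} (N : Set (GradedMC.E n))
    (hN : GradedMC.IsSubmanifoldWithCorners N) (hstar : StarConvex ℝ 0 N)
    {W : ℕ → Type*} [∀ k, NormedAddCommGroup (W k)] [∀ k, NormedSpace ℝ (W k)]
    [∀ k, FiniteDimensional ℝ (W k)] (hW : {k | Nontrivial (W k)}.Finite)
    (U : TopologicalSpace.Opens (W 0)) (Q : GradedMC.Differential U)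
    (A : GradedMC.Form0 n W) (hA : GradedMC.IsForm0In N U A) :
    GradedMC.IsForm0 N (GradedMC.kuranishi Q A) ∧
      ((∀ k, ∀ x ∈ N, GradedMC.dForm N A k x = GradedMC.FQ Q A k x) ↔
        ∀ k, ∀ x ∈ N, GradedMC.dForm N (GradedMC.kuranishi Q A) k x = 0) := by
  obtain ⟨O, B, hO, hNO, hOs, hB, hU, hAB⟩ := GradedMC.exists_extension hstar hW hA
  have hK : ∀ k, ContDiffOn ℝ ((⊤ : ℕ∞) : WithTop ℕ∞) (GradedMC.kuranishi Q B k) O := fun k =>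
    (hB k).sub (GradedMC.contDiffOn_hOp hO hOs (GradedMC.contDiffOn_FQ Q hB hU k))
  have hAK := GradedMC.eqOn_kuranishi Q hstar hAB
  have hcurv : ∀ k, ∀ x ∈ N, (GradedMC.dForm N A k x = GradedMC.FQ Q A k x ↔
      GradedMC.curvature Q B k x = 0) := by
    intro k x hx
    rw [GradedMC.dForm, GradedMC.extDerivWithin_eq_extDeriv hN.uniqueDiffOn hO hNO (hB k) (hAB k)
      hx, GradedMC.FQ_congr Q (fun j => hAB j hx), GradedMC.curvature, sub_eq_zero]
  have hkur : ∀ k, ∀ x ∈ N, GradedMC.dForm N (GradedMC.kuranishi Q A) k x =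
      GradedMC.curvature Q B k x + GradedMC.hOp (extDeriv (GradedMC.FQ Q B k)) x := by
    intro k x hx
    rw [GradedMC.dForm, GradedMC.extDerivWithin_eq_extDeriv hN.uniqueDiffOn hO hNO (hK k) (hAK k)
      hx, GradedMC.extDeriv_kuranishi Q hO hOs hB hU k (hNO hx)]
  refine ⟨fun k => ⟨O, _, hO, hNO, hK k, hAK k⟩, fun h k x hx => ?_, fun h k x hx => ?_⟩
  · have hzero : ∀ k, ∀ x ∈ N, GradedMC.curvature Q B k x = 0 := fun k x hx =>
      (hcurv k x hx).1 (h k x hx)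
    rw [hkur k x hx, hzero k x hx, zero_add]
    exact GradedMC.hOp_eq_zero hstar (fun y hy => GradedMC.extDeriv_FQ_eq_zero Q hO hB hU
      (hNO hy) (fun j => hzero j y hy) k) hx
  · exact (hcurv k x hx).2 (GradedMC.curvature_eq_zero Q hW hstar hO hNO hB hU
      (fun k x hx => (hkur k x hx).symm.trans (h k x hx)) hx k)
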